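/- Consider an $N$-player ($N\ge 2$) infinite-horizon discounted Markov potential game: a (possibly infinite) state set $\mathcal S$, action sets $\mathcal A_i$ with $|\mathcal A_i|=A\ge 1$, transition probabilities $\mathbb P(\cdot\mid s,a)$, rewards $r_i:\mathcal S\times\mathcal A\to[0,1]$, discount factor $\gamma\in[0,1)$ and initial state distribution $\rho$. For a product policy $\pi=(\pi_1,\dots,\pi_N)$, $\pi_i:\mathcal S\to\Delta(\mathcal A_i)$, let $V_i^\pi(s)$ and $Q_i^\pi(s,a)$ be the discounted value and action-value functions of player $i$, $V_i^\pi(\rho)=\mathbb E_{s\sim\rho}[V_i^\pi(s)]$, $\bar Q_i^\pi(s,a_i)=\sum_{a_{-i}}\pi_{-i}(a_{-i}\mid s)\,Q_i^\pi(s,a_i,a_{-i})$, and $d_\rho^\pi(s)=(1-\gamma)\,\mathbb E_{s^{(0)}\sim\rho}\big[\sum_{t\ge 0}\gamma^t\Pr^\pi(s^{(t)}=s\mid s^{(0)})\big]$. The game has a potential function $\Phi$: $V_i^{\pi_i,\pi_{-i}}(s)-V_i^{\pi_i',\pi_{-i}}(s)=\Phi^{\pi_i,\pi_{-i}}(s)-\Phi^{\pi_i',\pi_{-i}}(s)$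 for all $i,\pi_i,\pi_i',\pi_{-i},s$; and $\Phi^{\max}>0$ is a constant with $|\Phi^\pi(\mu)-\Phi^{\pi'}(\mu)|\le\Phi^{\max}$ for all $\pi,\pi'$ and all state distributions $\mu$, where $\Phi^\pi(\mu)=\mathbb E_{s\sim\mu}[\Phi^\pi(s)]$. Assume that $\kappa_\rho=\sup_\pi\|d_\rho^\pi/\rho\|_\infty$ is finite. Assumption 1 (linear averaged $Q$). There are feature maps $\phi_i:\mathcal S\times\mathcal A_i\to\mathbb R^d$ with $\|\phi_i(s,a_i)\|\le 1$, and $W>0$, such that for every $i$ and every policy $\pi$ there is $w_i^\pi\in\mathbb R^d$ with $\|w_i^\pi\|\le W$ and $\bar Q_i^\pi(s,a_i)=\langle\phi_i(s,a_i),w_i^\pi\rangle$ for all $(s,a_i)$. Algorithm 2 (stepsize $\eta>0$, exploration rate $\xi\in(0,1)$, $T\ge1$ iterations, $K$ rounds per iteration). Start with $\pi_i^{(1)}(\cdot\mid s)$ uniform. For $t=1,\dots,T$: (1) Data collection: in each of $K$ independent rounds draw, for each $i$, independent geometric variables $h_i\in\{0,1,\dots\}$ and $h_i'\in\{1,2,\dots\}$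 with parameter $1-\gamma$, run $\pi^{(t)}$ from $\bar s^{(0)}\sim\rho$ for $\max_i(h_i+h_i')$ steps, and record $s_i=\bar s^{(h_i)}$, $a_i=\bar a_i^{(h_i)}$, $R_i=\sum_{h=h_i}^{h_i+h_i'-1}\bar r_i^{(h)}$. (2) Policy update: each player $i$ computes an approximate minimizer $\hat w_i^{(t)}$, with $\|\hat w_i^{(t)}\|\le W$, of $\sum_{k=1}^K\big(R_i^{(k)}-\langle\phi_i(s_i^{(k)},a_i^{(k)}),w\rangle\big)^2$ over $\|w\|\le W$, and sets, for every $s$, \[\pi_i^{(t+1)}(\cdot\mid s)=\operatorname*{argmax}_{p\in\Delta_\xi(\mathcal A_i)}\Big\{\big\langle p,\hat Q_i^{(t)}(s,\cdot)\big\rangle-\tfrac1{2\eta}\big\|p-\pi_i^{(t)}(\cdot\mid s)\big\|^2\Big\},\] where $\hat Q_i^{(t)}(s,a_i)=\langle\phi_i(s,a_i),\hat w_i^{(t)}\rangle$ and $\Delta_\xi(\mathcal A_i)=\{(1-\xi)q+\xi\,\mathrm{Unif}_{\mathcal A_i}:q\in\Delta(\mathcal A_i)\}$. Assumption 2 (bounded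 statistical error). $\varepsilon_{\rm stat}>0$ is such that, for all $i$ and all $t\le T$, $\mathbb E\big[L_i^{(t)}(\hat w_i^{(t)})\big]\le\varepsilon_{\rm stat}$, where $L_i^{(t)}(w)=\mathbb E_{s\sim d_\rho^{\pi^{(t)}},\,a_i\sim\pi_i^{(t)}(\cdot\mid s)}\big[(\bar Q_i^{\pi^{(t)}}(s,a_i)-\langle\phi_i(s,a_i),w\rangle)^2\big]$. Theorem. There is an absolute constant $C>0$ such that, in every such setting, if all players run Algorithm 2 with $\xi=\min\Big(\big(\tfrac{\kappa_\rho^2NA\varepsilon_{\rm stat}}{(1-\gamma)^2W^2}\big)^{1/3},\tfrac12\Big)$ and one of the two stepsizes below, then \[\mathbb E\Big[\frac1T\sum_{t=1}^T\max_i\Big(\max_{\pi_i'}V_i^{\pi_i',\pi_{-i}^{(t)}}(\rho)-V_i^{\pi^{(t)}}(\rho)\Big)\Big]\le C\left(\mathcal R(\eta)+\Big(\frac{\kappa_\rho^2\,WAN\,\varepsilon_{\rm stat}}{(1-\gamma)^5}\Big)^{1/3}\right),\] \[\mathcal R(\eta)=\begin{cases}\dfrac{\sqrt{\kappa_\rho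 WN}\,(A\Phi^{\max})^{1/4}}{(1-\gamma)^{7/4}\,T^{1/4}},&\eta=\dfrac{(1-\gamma)^{3/2}\sqrt{\Phi^{\max}}}{WN\sqrt{AT}},\\[3mm]\dfrac{\kappa_\rho^2\sqrt{AN\Phi^{\max}}}{(1-\gamma)^3\sqrt T},&\eta=\dfrac{(1-\gamma)^4}{16\,\kappa_\rho^3NA}.\end{cases}\] -/

import Mathlib

open scoped ENNReal BigOperators
open MeasureTheory

noncomputable section

namespace MPG

/-- Expectation of a real function under a probability mass function. -/
def expect {α : Type*} (p : PMF α) (f : α → ℝ) : ℝ := ∑' x, (p x).toReal * f x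

/-- Law of independent draws `x j ∼ p j`, `j < n`. -/
def indepPMF {α : Type*} : (n : ℕ) → (Fin n → PMF α) → PMF (Fin n → α)
  | 0, _ => PMF.pure Fin.elim0
  | n + 1, p => (p 0).bind fun x => (indepPMF n fun j => p j.succ).map (Fin.cons x)

/-- Geometric law with success probability `1 - γ`, counting failures: `n ↦ (1 - γ) γ ^ n`. -/
def geomPMF (γ : ℝ) (h0 : 0 ≤ γ) (h1 : γ < 1) : PMF ℕ :=
  ⟨fun n => ENNReal.ofReal ((1 - γ) * γ ^ n), by
    have hs : HasSum (fun n : ℕ => (1 - γ) * γ ^ n) 1 := by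
      have h := (hasSum_geometric_of_lt_one h0 h1).mul_left (1 - γ)
      rwa [mul_inv_cancel₀ (by linarith)] at h
    have hn : ∀ n : ℕ, 0 ≤ (1 - γ) * γ ^ n := fun n =>
      mul_nonneg (by linarith) (pow_nonneg h0 n)
    have h2 := ENNReal.ofReal_tsum_of_nonneg hn hs.summable
    rw [hs.tsum_eq, ENNReal.ofReal_one] at h2
    rw [h2]
    exact ENNReal.summable.hasSum⟩

/-- An `N`-player discounted Markov game on a (possibly infinite) state set `S` in which every
player has `A` actions; transition and initial laws are given by probability mass functions. -/
structure Game (N A : ℕ) (S : Type*) where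
  /-- transition law -/
  P : S → (Fin N → Fin A) → PMF S
  /-- reward functions -/
  r : Fin N → S → (Fin N → Fin A) → ℝ
  /-- discount factor -/
  γ : ℝ
  /-- initial state distribution -/
  ρ : PMF S
  r_mem : ∀ i s a, r i s a ∈ Set.Icc (0 : ℝ) 1
  γ_nonneg : 0 ≤ γ
  γ_lt_one : γ < 1

/-- A policy of one player: a distribution over her actions for each state. -/
abbrev PlayerPolicy (A : ℕ) (S : Type*) := S → stdSimplex ℝ (Fin A)

/-- A joint (product) Markov policy. -/
abbrev Policy (N A : ℕ) (S : Type*) := Fin N → PlayerPolicy A S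

variable {N A d : ℕ} {S : Type*}

/-- The product law of the joint action in state `s`. -/
def jointAct (π : Policy N A S) (s : S) : PMF (Fin N → Fin A) :=
  PMF.ofFintype (fun a => ENNReal.ofReal (∏ i, (π i s).1 (a i))) (by
    rw [← ENNReal.ofReal_sum_of_nonneg
      (fun a _ => Finset.prod_nonneg fun i _ => (π i s).2.1 (a i)),
      ← Fintype.prod_sum (fun i b => (π i s).1 b)]
    simp [(fun i => (π i s).2.2 : ∀ i, ∑ b, (π i s).1 b = 1)])

/-- Attach to a random state a joint action drawn from the policy. -/
def withAct (π : Policy N A S) (μ : PMF S) : PMF (S × (Fin N → Fin A)) :=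
  μ.bind fun s => (jointAct π s).map (Prod.mk s)

namespace Game

/-- One step of the state-action chain. -/
def step (G : Game N A S) (π : Policy N A S) (x : S × (Fin N → Fin A)) :
    PMF (S × (Fin N → Fin A)) :=
  withAct π (G.P x.1 x.2)

/-- Law of `(s⁽ᵗ⁾, a⁽ᵗ⁾)` when `(s⁽⁰⁾, a⁽⁰⁾)` has law `init` and `π` is played afterwards. -/
def saLaw (G : Game N A S) (π : Policy N A S) (init : PMF (S × (Fin N → Fin A))) :
    ℕ → PMF (S × (Fin N → Fin A))
  | 0 => init
  | t + 1 => (G.saLaw π init t).bind (G.step π)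

/-- Expected discounted reward `∑ₜ γᵗ E[rᵢ(s⁽ᵗ⁾, a⁽ᵗ⁾)]`, with `(s⁽⁰⁾, a⁽⁰⁾)` of law `init`. -/
def discReward (G : Game N A S) (π : Policy N A S) (init : PMF (S × (Fin N → Fin A)))
    (i : Fin N) : ℝ :=
  ∑' t : ℕ, G.γ ^ t * expect (G.saLaw π init t) fun x => G.r i x.1 x.2

/-- Value function `V_i^π(s)`. -/
def V (G : Game N A S) (π : Policy N A S) (i : Fin N) (s : S) : ℝ :=
  G.discReward π (withAct π (PMF.pure s)) i

/-- Value `V_i^π(ρ)` at the initial distribution. -/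
def Vρ (G : Game N A S) (π : Policy N A S) (i : Fin N) : ℝ := expect G.ρ (G.V π i)

/-- Action-value function `Q_i^π(s, a)`. -/
def Q (G : Game N A S) (π : Policy N A S) (i : Fin N) (s : S) (a : Fin N → Fin A) : ℝ :=
  G.discReward π (PMF.pure (s, a)) i

/-- Averaged action-value function: the actions of the other players are averaged out. -/
def Qbar (G : Game N A S) (π : Policy N A S) (i : Fin N) (s : S) (b : Fin A) : ℝ :=
  ∑ a : Fin N → Fin A with a i = b,
    (∏ j ∈ Finset.univ.erase i, (π j s).1 (a j)) * G.Q π i s a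

/-- Discounted state visitation distribution started at `s₀`. -/
def visitFrom (G : Game N A S) (π : Policy N A S) (s₀ s : S) : ℝ≥0∞ :=
  ENNReal.ofReal (1 - G.γ) *
    ∑' t : ℕ, ENNReal.ofReal (G.γ ^ t) *
      ((G.saLaw π (withAct π (PMF.pure s₀)) t).map Prod.fst) s

/-- Discounted state visitation distribution `d_ρ^π`. -/
def visit (G : Game N A S) (π : Policy N A S) (s : S) : ℝ≥0∞ :=
  ∑' s₀, G.ρ s₀ * G.visitFrom π s₀ s

/-- Distribution mismatch coefficient `κ_ρ`, in `[0, ∞]`; here `x / 0 = ∞` for `x ≠ 0`, and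
`0 / 0 = 0` (such states are never visited from `ρ`). -/
def kappa (G : Game N A S) : ℝ≥0∞ := ⨆ π : Policy N A S, ⨆ s : S, G.visit π s / G.ρ s

/-- `Φ` is a potential function: the game is a Markov potential game. -/
def IsPotential (G : Game N A S) (Φ : Policy N A S → S → ℝ) : Prop :=
  ∀ (i : Fin N) (π : Policy N A S) (p p' : PlayerPolicy A S) (s : S),
    G.V (Function.update π i p) i s - G.V (Function.update π i p') i s =
      Φ (Function.update π i p) s - Φ (Function.update π i p') s

/-- Local gap of player `i`: best response value minus current value. -/
def gap (G : Game N A S) (π : Policy N A S) (i : Fin N) : ℝ :=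
  (⨆ p : PlayerPolicy A S, G.Vρ (Function.update π i p) i) - G.Vρ π i

/-- Nash regret of the policies `π 1, …, π T`. -/
def nashRegret (G : Game N A S) (T : ℕ) (π : ℕ → Policy N A S) : ℝ :=
  (1 / (T : ℝ)) * ∑ t ∈ Finset.Icc 1 T, ⨆ i : Fin N, G.gap (π t) i

/-- The averaged action values of every player are linear in the features `φ i`, which have norm
at most `1`, with weights of norm at most `W`. -/
def LinearQ (G : Game N A S) (φ : Fin N → S → Fin A → EuclideanSpace ℝ (Fin d)) (W : ℝ) : Prop :=
  (∀ i s b, ‖φ i s b‖ ≤ 1) ∧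
  ∀ (i : Fin N) (π : Policy N A S), ∃ w : EuclideanSpace ℝ (Fin d),
    ‖w‖ ≤ W ∧ ∀ s b, G.Qbar π i s b = inner ℝ (φ i s b) w

/-- Expected regression loss of the weight `w` for player `i` at policy `π`, the pair `(s, aᵢ)`
being drawn as `s ∼ d_ρ^π`, `aᵢ ∼ πᵢ(· | s)`. -/
def regLoss (G : Game N A S) (φ : Fin N → S → Fin A → EuclideanSpace ℝ (Fin d))
    (π : Policy N A S) (i : Fin N) (w : EuclideanSpace ℝ (Fin d)) : ℝ :=
  ∑' s, (G.visit π s).toReal *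
    ∑ b, (π i s).1 b * (G.Qbar π i s b - inner ℝ (φ i s b) w) ^ 2

/-- Law of a trajectory run for `H` steps under `π` from `s⁽⁰⁾ ∼ ρ`: entries `0, …, H` are the
visited state-action pairs (entries beyond `H` just repeat the last pair and are not used). -/
def trajLaw (G : Game N A S) (π : Policy N A S) : ℕ → PMF (ℕ → S × (Fin N → Fin A))
  | 0 => (withAct π G.ρ).map fun x _ => x
  | H + 1 => (G.trajLaw π H).bind fun τ =>
      (G.step π (τ H)).map fun x n => if n ≤ H then τ n else x

/-- The horizons `(hᵢ, hᵢ')` of all players: independent geometric variables with parameter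
`1 - γ`; `hᵢ` takes values in `{0, 1, …}` and `hᵢ'` in `{1, 2, …}`. -/
def horizonLaw (G : Game N A S) : PMF (Fin N → ℕ × ℕ) :=
  indepPMF N fun _ =>
    (geomPMF G.γ G.γ_nonneg G.γ_lt_one).bind fun h =>
      (geomPMF G.γ G.γ_nonneg G.γ_lt_one).map fun h' => (h, h' + 1)

/-- Law of the sample tuples `(sᵢ, aᵢ, Rᵢ)` of all players in one data collection round. -/
def roundLaw (G : Game N A S) (π : Policy N A S) : PMF (Fin N → S × Fin A × ℝ) :=
  G.horizonLaw.bind fun h =>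
    (G.trajLaw π (Finset.univ.sup fun i => (h i).1 + (h i).2)).map fun τ i =>
      ((τ (h i).1).1, (τ (h i).1).2 i,
        ∑ n ∈ Finset.Ico (h i).1 ((h i).1 + (h i).2), G.r i (τ n).1 (τ n).2)

/-- Law of the data of `K` independent rounds. -/
def dataLaw (G : Game N A S) (π : Policy N A S) (K : ℕ) :
    PMF (Fin K → Fin N → S × Fin A × ℝ) :=
  indepPMF K fun _ => G.roundLaw π

end Game

/-- The `ξ`-greedy simplex `{(1 - ξ) q + ξ Unif : q ∈ Δ}`. -/
def greedySimplex (A : ℕ) (ξ : ℝ) : Set (Fin A → ℝ) :=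
  {p | ∃ q ∈ stdSimplex ℝ (Fin A), p = fun b => (1 - ξ) * q b + ξ * (1 / (A : ℝ))}

/-- Objective of the proximal policy step: `⟨p, q⟩ - ‖p - p₀‖² / (2 η)`. -/
def proxObj (η : ℝ) (q p₀ p : Fin A → ℝ) : ℝ :=
  ∑ b, p b * q b - 1 / (2 * η) * ∑ b, (p b - p₀ b) ^ 2

/-- Empirical squared loss of player `i` on the collected data. -/
def empLoss {K : ℕ} (φ : Fin N → S → Fin A → EuclideanSpace ℝ (Fin d))
    (D : Fin K → Fin N → S × Fin A × ℝ) (i : Fin N) (w : EuclideanSpace ℝ (Fin d)) : ℝ :=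
  ∑ k, ((D k i).2.2 - inner ℝ (φ i (D k i).1 (D k i).2.1) w) ^ 2

/-- A run, for `T` iterations on a probability space `(Ω, μ)`, of independent policy gradient with
linear function approximation: features `φ`, weight radius `W`, stepsize `η`, exploration rate
`ξ`, and `K` data collection rounds per iteration. -/
structure Run (G : Game N A S) (φ : Fin N → S → Fin A → EuclideanSpace ℝ (Fin d))
    (W η ξ : ℝ) (K T : ℕ) {Ω : Type*} [mΩ : MeasurableSpace Ω] (μ : Measure Ω) where
  /-- `ℱ t`: everything that has happened before iteration `t` -/
  ℱ : Filtration ℕ mΩ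
  /-- the policies `π⁽ᵗ⁾` -/
  policy : ℕ → Ω → Policy N A S
  /-- the data collected in iteration `t` -/
  data : ℕ → Ω → Fin K → Fin N → S × Fin A × ℝ
  /-- the estimated weights `ŵᵢ⁽ᵗ⁾` -/
  what : ℕ → Fin N → Ω → EuclideanSpace ℝ (Fin d)
  /-- the optimization error with which the regression problem is solved -/
  optErr : ℕ → Fin N → Ω → ℝ
  /-- the initial policy is uniform -/
  policy_one : ∀ ω i s b, (policy 1 ω i s).1 b = 1 / (A : ℝ)
  data_meas : ∀ t ∈ Finset.Icc 1 T, ∀ x, MeasurableSet[ℱ (t + 1)] {ω | data t ω = x}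
  /-- data collection: given the past, the data consist of `K` independent rounds under the
  current policy -/
  data_law : ∀ t ∈ Finset.Icc 1 T, ∀ B : Set Ω, MeasurableSet[ℱ t] B → ∀ x,
    μ (B ∩ {ω | data t ω = x}) = ∫⁻ ω in B, G.dataLaw (policy t ω) K x ∂μ
  what_meas : ∀ t ∈ Finset.Icc 1 T, ∀ i, Measurable[ℱ (t + 1)] (what t i)
  /-- the weights are an approximate least-squares solution over the ball of radius `W` -/
  what_norm : ∀ t ∈ Finset.Icc 1 T, ∀ i ω, ‖what t i ω‖ ≤ W
  what_approx : ∀ t ∈ Finset.Icc 1 T, ∀ i ω, ∀ w : EuclideanSpace ℝ (Fin d), ‖w‖ ≤ W →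
    empLoss φ (data t ω) i (what t i ω) ≤ empLoss φ (data t ω) i w + optErr t i ω
  /-- policy update: maximization of the proximal objective over the `ξ`-greedy simplex, in
  every state and for every player -/
  policy_mem : ∀ t ∈ Finset.Icc 1 T, ∀ ω i s, (policy (t + 1) ω i s).1 ∈ greedySimplex A ξ
  policy_max : ∀ t ∈ Finset.Icc 1 T, ∀ ω i s, IsMaxOn
    (proxObj η (fun b => inner ℝ (φ i s b) (what t i ω)) (policy t ω i s).1)
    (greedySimplex A ξ) (policy (t + 1) ω i s).1

end MPG

end

/-! Write δ = 1 - γ and κ for the mismatch coefficient. The potential rises whenever the players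
move, so over T rounds the total squared displacement of the policies is bounded; a small
displacement in turn forces a small best-response gap. All of this holds pathwise, and only the
regression loss is averaged, at the very end.

Values are resolvents ∑ γ^t P_π^t f of the state chain. Bounded sub- and supersolutions of g = f + γ
P_π g can be compared with the resolvent (`nonpos_of_le_trans`), and the performance difference
formula `V_sub_V` follows by uniqueness. The coefficient κ acts through one inequality, δ
E_ρ[resolvent f] ≤ κ E_ρ[f] for f ≥ 0 under any policy (`expect_resolvent_le`), so displacements and
errors can all be measured under ρ.

To bound the rise of the potential, the players are switched to their new policies one at a time
(`mix`). Each switch is unilateral, so the potential changes by a difference of V_i, that is, by the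
discounted sum of ⟨π'_i - π_i, Qbar_i⟩ with Qbar_i taken at the hybrid policy. Passing to Qbar_i at
the old policy π costs a second-order term (`occ_interaction_le`), passing to the estimate costs the
squared regression error, and the proximal step makes ⟨π'_i - π_i, estimate⟩ at least ‖π'_i -
π_i‖²/η. If 16κNAη ≤ δ³, the interaction is absorbed (`potential_improvement`).

The gap is controlled by first-order optimality of the proximal step against the ξ-greedy version of
any deviation (`gap_le_update`). Exploration gives every action probability at least ξ/A, which
turns the on-policy loss into a squared error summed over all actions (`expect_sqErr_le`). Free
AM-GM weights are then balanced in `lintegral_nashRegret_le`, giving a multiple of √(κΦmax/(Tη))/δ +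
ξW/δ. The first term yields both rates, and the choice of ξ makes the second the statistical term.
If ξ is truncated at 1/2, or the stepsize is too large, the trivial bound 2W/δ is already small
enough. -/

noncomputable section

namespace MPG

/-! ### Bounded functions -/

/-- A bounded real function. -/
def Bdd {α : Type*} (f : α → ℝ) : Prop := ∃ B, ∀ x, |f x| ≤ B

namespace Bdd
variable {α β : Type*} {f g : α → ℝ}

theorem nonneg_bound (hf : Bdd f) : ∃ B, 0 ≤ B ∧ ∀ x, |f x| ≤ B := by
  obtain ⟨B, hB⟩ := hf
  exact ⟨|B|, abs_nonneg _, fun x => (hB x).trans (le_abs_self B)⟩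

theorem const (c : ℝ) : Bdd (fun _ : α => c) := ⟨|c|, fun _ => le_rfl⟩

theorem add (hf : Bdd f) (hg : Bdd g) : Bdd (fun x => f x + g x) := by
  obtain ⟨B, hB⟩ := hf
  obtain ⟨C, hC⟩ := hg
  exact ⟨B + C, fun x => (abs_add_le _ _).trans (add_le_add (hB x) (hC x))⟩

theorem mul (hf : Bdd f) (hg : Bdd g) : Bdd (fun x => f x * g x) := by
  obtain ⟨B, hB0, hB⟩ := hf.nonneg_bound
  obtain ⟨C, hC⟩ := hg
  exact ⟨B * C, fun x => by
    rw [abs_mul]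
    exact mul_le_mul (hB x) (hC x) (abs_nonneg _) hB0⟩

theorem const_mul (c : ℝ) (hf : Bdd f) : Bdd (fun x => c * f x) := (const c).mul hf

theorem neg (hf : Bdd f) : Bdd (fun x => -f x) := by
  obtain ⟨B, hB⟩ := hf
  exact ⟨B, fun x => by rw [abs_neg]; exact hB x⟩

theorem sub (hf : Bdd f) (hg : Bdd g) : Bdd (fun x => f x - g x) := by
  simpa [sub_eq_add_neg] using hf.add hg.neg

theorem sq (hf : Bdd f) : Bdd (fun x => f x ^ 2) := by
  simpa [pow_two] using hf.mul hf

theorem abs (hf : Bdd f) : Bdd (fun x => |f x|) := by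
  obtain ⟨B, hB⟩ := hf
  exact ⟨B, fun x => by rw [abs_abs]; exact hB x⟩

theorem sum {ι : Type*} (s : Finset ι) {f : ι → α → ℝ} (hf : ∀ i ∈ s, Bdd (f i)) :
    Bdd (fun x => ∑ i ∈ s, f i x) := by
  classical
  induction s using Finset.induction_on with
  | empty => simpa using const 0
  | insert i s hi ih =>
    simp only [Finset.sum_insert hi]
    exact (hf i (by simp)).add (ih fun j hj => hf j (by simp [hj]))

theorem comp (hf : Bdd f) (φ : β → α) : Bdd (fun x => f (φ x)) := by
  obtain ⟨B, hB⟩ := hf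
  exact ⟨B, fun x => hB _⟩

end Bdd

/-! ### Expectations under a probability mass function -/

section Expect
variable {α β : Type*} {f g : α → ℝ}

theorem summable_toReal (p : PMF α) : Summable fun x => (p x).toReal :=
  ENNReal.summable_toReal p.tsum_coe_ne_top

theorem tsum_toReal (p : PMF α) : ∑' x, (p x).toReal = 1 := by
  rw [← ENNReal.tsum_toReal_eq fun x => p.apply_ne_top x, p.tsum_coe, ENNReal.toReal_one]

theorem summable_expect (p : PMF α) (hf : Bdd f) : Summable fun x => (p x).toReal * f x := by
  obtain ⟨B, hB⟩ := hf
  refine Summable.of_norm_bounded ((summable_toReal p).mul_right B) fun x => ?_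
  rw [Real.norm_eq_abs, abs_mul, abs_of_nonneg ENNReal.toReal_nonneg]
  exact mul_le_mul_of_nonneg_left (hB x) ENNReal.toReal_nonneg

theorem expect_add (p : PMF α) (hf : Bdd f) (hg : Bdd g) :
    expect p (fun x => f x + g x) = expect p f + expect p g := by
  simp only [expect, mul_add]
  exact (summable_expect p hf).tsum_add (summable_expect p hg)

theorem expect_const_mul (p : PMF α) (c : ℝ) (f : α → ℝ) :
    expect p (fun x => c * f x) = c * expect p f := by
  simp only [expect, mul_left_comm _ c]
  exact tsum_mul_left

theorem expect_neg (p : PMF α) (f : α → ℝ) : expect p (fun x => -f x) = -expect p f := by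
  simpa using expect_const_mul p (-1) f

theorem expect_sub (p : PMF α) (hf : Bdd f) (hg : Bdd g) :
    expect p (fun x => f x - g x) = expect p f - expect p g := by
  simp only [sub_eq_add_neg]
  rw [expect_add p hf hg.neg, expect_neg]

theorem expect_const (p : PMF α) (c : ℝ) : expect p (fun _ => c) = c := by
  simp only [expect, tsum_mul_right, tsum_toReal, one_mul]

theorem expect_mono (p : PMF α) (hf : Bdd f) (hg : Bdd g) (h : ∀ x, f x ≤ g x) :
    expect p f ≤ expect p g :=
  (summable_expect p hf).tsum_le_tsum
    (fun x => mul_le_mul_of_nonneg_left (h x) ENNReal.toReal_nonneg) (summable_expect p hg)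

theorem expect_nonneg (p : PMF α) (h : ∀ x, 0 ≤ f x) : 0 ≤ expect p f :=
  tsum_nonneg fun x => mul_nonneg ENNReal.toReal_nonneg (h x)

theorem abs_expect_le (p : PMF α) {B : ℝ} (h : ∀ x, |f x| ≤ B) : |expect p f| ≤ B := by
  have hf : Bdd f := ⟨B, h⟩
  rw [abs_le]
  constructor
  · rw [← expect_const p (-B)]
    exact expect_mono p (Bdd.const _) hf fun x => (abs_le.1 (h x)).1
  · calc expect p f ≤ expect p fun _ => B := expect_mono p hf (Bdd.const _) fun x => (abs_le.1 (h x)).2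
      _ = B := expect_const p B

theorem abs_expect_le_expect (p : PMF α) (hf : Bdd f) :
    |expect p f| ≤ expect p fun x => |f x| := by
  rw [abs_le]
  constructor
  · rw [← expect_neg]
    exact expect_mono p hf.abs.neg hf fun x => neg_abs_le _
  · exact expect_mono p hf hf.abs fun x => le_abs_self _

theorem expect_sum {ι : Type*} (p : PMF α) (s : Finset ι) {f : ι → α → ℝ}
    (hf : ∀ i ∈ s, Bdd (f i)) :
    expect p (fun x => ∑ i ∈ s, f i x) = ∑ i ∈ s, expect p (f i) := by
  simp only [expect, Finset.mul_sum]
  exact Summable.tsum_finsetSum fun i hi => summable_expect p (hf i hi)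

theorem expect_pure (a : α) (f : α → ℝ) : expect (PMF.pure a) f = f a := by
  rw [expect, tsum_eq_single a]
  · simp
  · intro b hb
    simp [PMF.pure_apply_of_ne _ _ hb]

theorem expect_bind (p : PMF α) (q : α → PMF β) {f : β → ℝ} (hf : Bdd f) :
    expect (p.bind q) f = expect p fun x => expect (q x) f := by
  obtain ⟨B, hB0, hB⟩ := hf.nonneg_bound
  have hs : Summable fun z : α × β => (p z.1).toReal * (q z.1 z.2).toReal := by
    have h0 : (0 : α × β → ℝ) ≤ fun z => (p z.1).toReal * (q z.1 z.2).toReal := by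
      intro z
      simp only [Pi.zero_apply]
      positivity
    refine (summable_prod_of_nonneg h0).2 ⟨fun x => (summable_toReal (q x)).mul_left (p x).toReal, ?_⟩
    simp only [tsum_mul_left, tsum_toReal, mul_one]
    exact summable_toReal p
  have hsf : Summable fun z : α × β => (p z.1).toReal * ((q z.1 z.2).toReal * f z.2) := by
    refine Summable.of_norm_bounded (hs.mul_right B) fun z => ?_
    rw [← mul_assoc, Real.norm_eq_abs, abs_mul, abs_of_nonneg (by positivity)]
    exact mul_le_mul_of_nonneg_left (hB _) (by positivity)
  have h1 : ∀ y, ((p.bind q) y).toReal * f y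
      = ∑' x, (p x).toReal * ((q x y).toReal * f y) := by
    intro y
    rw [PMF.bind_apply, ENNReal.tsum_toReal_eq fun x =>
      ENNReal.mul_ne_top (p.apply_ne_top x) ((q x).apply_ne_top y), ← tsum_mul_right]
    simp only [ENNReal.toReal_mul, mul_assoc]
  simp only [expect, h1, ← tsum_mul_left]
  exact Summable.tsum_comm hsf

theorem expect_map (p : PMF α) (φ : α → β) {f : β → ℝ} (hf : Bdd f) :
    expect (p.map φ) f = expect p fun x => f (φ x) := by
  rw [PMF.map, expect_bind p _ hf]
  simp only [Function.comp, expect_pure]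

theorem expect_tsum (p : PMF α) {h : ℕ → α → ℝ} {c : ℕ → ℝ} (hc : Summable c)
    (hh : ∀ t x, |h t x| ≤ c t) :
    expect p (fun x => ∑' t, h t x) = ∑' t, expect p (h t) := by
  have hc0 : ∀ t, 0 ≤ c t := fun t => by
    obtain ⟨x, -⟩ := p.support_nonempty
    exact (abs_nonneg _).trans (hh t x)
  have hs : Summable fun z : ℕ × α => (p z.2).toReal * h z.1 z.2 := by
    refine Summable.of_norm_bounded ((hc.mul_of_nonneg (summable_toReal p) hc0
      fun _ => ENNReal.toReal_nonneg)) fun z => ?_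
    rw [Real.norm_eq_abs, abs_mul, abs_of_nonneg ENNReal.toReal_nonneg, mul_comm]
    exact mul_le_mul_of_nonneg_right (hh _ _) ENNReal.toReal_nonneg
  simp only [expect, ← tsum_mul_left]
  exact Summable.tsum_comm hs

theorem sq_expect_le (p : PMF α) (hf : Bdd f) :
    expect p f ^ 2 ≤ expect p fun x => f x ^ 2 := by
  have h := expect_mono p (hf.const_mul (2 * expect p f))
    (hf.sq.add (Bdd.const (expect p f ^ 2))) fun x => by
      nlinarith [sq_nonneg (f x - expect p f)]
  rw [expect_const_mul, expect_add p hf.sq (Bdd.const _), expect_const] at h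
  nlinarith

theorem ofReal_expect (p : PMF α) (hf : Bdd f) (h0 : ∀ x, 0 ≤ f x) :
    ENNReal.ofReal (expect p f) = ∑' x, p x * ENNReal.ofReal (f x) := by
  rw [expect, ENNReal.ofReal_tsum_of_nonneg
    (fun x => mul_nonneg ENNReal.toReal_nonneg (h0 x)) (summable_expect p hf)]
  refine tsum_congr fun x => ?_
  rw [ENNReal.ofReal_mul ENNReal.toReal_nonneg, ENNReal.ofReal_toReal (p.apply_ne_top x)]

/-- The index type may be uncountable, but a probability mass function has countable support, so the
sum is a countable sum of measurable functions. -/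
theorem measurable_expect {Ω : Type*} [MeasurableSpace Ω] (p : PMF α) {f : Ω → α → ℝ}
    (hf : ∀ x, Measurable fun ω => f ω x) : Measurable fun ω => expect p (f ω) := by
  have : Countable p.support := p.support_countable
  have h : ∀ ω, expect p (f ω) = ∑' x : p.support, (p x).toReal * f ω x := by
    intro ω
    rw [expect, ← tsum_subtype_eq_of_support_subset (s := p.support)]
    intro x hx
    rw [PMF.mem_support_iff]
    intro h0
    simp [h0] at hx
  simp only [h]
  exact Measurable.tsum fun x => (hf x).const_mul _

end Expect
-- Product laws of joint actions
variable {N A d : ℕ} {S : Type*}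

theorem Bdd.of_finite {α : Type*} [Finite α] (f : α → ℝ) : Bdd f := by
  obtain ⟨B, hB⟩ := (Set.finite_range fun x => |f x|).bddAbove
  exact ⟨B, fun x => hB ⟨x, rfl⟩⟩

theorem expect_eq_sum {α : Type*} [Fintype α] (p : PMF α) (f : α → ℝ) :
    expect p f = ∑ x, (p x).toReal * f x := tsum_fintype _

theorem jointAct_toReal (π : Policy N A S) (s : S) (a : Fin N → Fin A) :
    (jointAct π s a).toReal = ∏ i, (π i s).1 (a i) := by
  rw [jointAct, PMF.ofFintype_apply,
    ENNReal.toReal_ofReal (Finset.prod_nonneg fun i _ => (π i s).2.1 (a i))]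

theorem expect_jointAct (π : Policy N A S) (s : S) (g : (Fin N → Fin A) → ℝ) :
    expect (jointAct π s) g = ∑ a, (∏ i, (π i s).1 (a i)) * g a := by
  simp only [expect_eq_sum, jointAct_toReal]

theorem expect_withAct (π : Policy N A S) (μ : PMF S) {g : S × (Fin N → Fin A) → ℝ} (hg : Bdd g) :
    expect (withAct π μ) g = expect μ fun s => expect (jointAct π s) fun a => g (s, a) := by
  rw [withAct, expect_bind _ _ hg]
  simp only [expect_map _ _ hg]

theorem Bdd.expect {α β : Type*} {g : α → β → ℝ} {B : ℝ} (hg : ∀ x y, |g x y| ≤ B)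
    (p : α → PMF β) : Bdd fun x => MPG.expect (p x) (g x) :=
  ⟨B, fun x => abs_expect_le _ (hg x)⟩

/-! ### The resolvent of the state chain and the comparison principle -/

namespace Game
variable (G : Game N A S)

/-- Law of the next state when `π` is played in state `s`. -/
def nextLaw (π : Policy N A S) (s : S) : PMF S := (jointAct π s).bind (G.P s)

/-- Transition operator of the state chain under `π`. -/
def trans (π : Policy N A S) (f : S → ℝ) (s : S) : ℝ := expect (G.nextLaw π s) f

/-- Expected discounted sum of `f` along the state chain under `π`. -/
def resolvent (π : Policy N A S) (f : S → ℝ) (s : S) : ℝ :=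
  ∑' t : ℕ, G.γ ^ t * (G.trans π)^[t] f s

variable {G} {π : Policy N A S} {f g : S → ℝ}

theorem one_sub_pos : 0 < 1 - G.γ := sub_pos.2 G.γ_lt_one

theorem trans_eq (π : Policy N A S) (hf : Bdd f) (s : S) :
    G.trans π f s = expect (jointAct π s) fun a => expect (G.P s a) f :=
  expect_bind _ _ hf

theorem abs_trans_le {B : ℝ} (h : ∀ s, |f s| ≤ B) (s : S) : |G.trans π f s| ≤ B :=
  abs_expect_le _ h

theorem bdd_trans (hf : Bdd f) : Bdd (G.trans π f) := by
  obtain ⟨B, hB⟩ := hf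
  exact ⟨B, abs_trans_le hB⟩

theorem abs_iterate_trans_le {B : ℝ} (h : ∀ s, |f s| ≤ B) (t : ℕ) :
    ∀ s, |(G.trans π)^[t] f s| ≤ B := by
  induction t with
  | zero => exact h
  | succ t ih =>
    intro s
    rw [Function.iterate_succ_apply']
    exact abs_trans_le ih s

theorem abs_resolvent_term_le {B : ℝ} (h : ∀ s, |f s| ≤ B) (t : ℕ) (s : S) :
    |G.γ ^ t * (G.trans π)^[t] f s| ≤ B * G.γ ^ t := by
  rw [abs_mul, abs_of_nonneg (pow_nonneg G.γ_nonneg t), mul_comm]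
  exact mul_le_mul_of_nonneg_right (abs_iterate_trans_le h t s) (pow_nonneg G.γ_nonneg t)

theorem summable_bound (B : ℝ) : Summable fun t : ℕ => B * G.γ ^ t :=
  (summable_geometric_of_lt_one G.γ_nonneg G.γ_lt_one).mul_left B

theorem summable_resolvent (hf : Bdd f) (s : S) :
    Summable fun t : ℕ => G.γ ^ t * (G.trans π)^[t] f s := by
  obtain ⟨B, hB⟩ := hf
  exact Summable.of_norm_bounded (summable_bound B) fun t => abs_resolvent_term_le hB t s

theorem bdd_resolvent (hf : Bdd f) : Bdd (G.resolvent π f) := by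
  obtain ⟨B, hB⟩ := hf
  refine ⟨∑' t : ℕ, B * G.γ ^ t, fun s => ?_⟩
  rw [resolvent, ← Real.norm_eq_abs]
  exact tsum_of_norm_bounded (summable_bound B).hasSum fun t => abs_resolvent_term_le hB t s

theorem expect_resolvent (p : PMF S) (hf : Bdd f) :
    expect p (G.resolvent π f) = ∑' t : ℕ, G.γ ^ t * expect p ((G.trans π)^[t] f) := by
  obtain ⟨B, hB⟩ := hf
  have h := expect_tsum p (h := fun t s => G.γ ^ t * (G.trans π)^[t] f s) (summable_bound B)
    fun t s => abs_resolvent_term_le hB t s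
  simp only [expect_const_mul] at h
  exact h

theorem resolvent_eq (hf : Bdd f) (s : S) :
    G.resolvent π f s = f s + G.γ * G.trans π (G.resolvent π f) s := by
  rw [trans, expect_resolvent _ hf, resolvent, (summable_resolvent hf s).tsum_eq_zero_add,
    ← tsum_mul_left]
  simp only [pow_zero, one_mul, Function.iterate_zero, id]
  congr 1
  refine tsum_congr fun t => ?_
  rw [pow_succ, Function.iterate_succ_apply', trans]
  ring

theorem trans_mono (hf : Bdd f) (hg : Bdd g) (h : ∀ s, f s ≤ g s) (s : S) :
    G.trans π f s ≤ G.trans π g s := expect_mono _ hf hg h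

/-- Comparison principle: iterating the hypothesis n times bounds f by γ^n B, which tends to 0.
Boundedness is essential here. -/
theorem nonpos_of_le_trans (hf : Bdd f) (h : ∀ s, f s ≤ G.γ * G.trans π f s) (s : S) :
    f s ≤ 0 := by
  obtain ⟨B, hB⟩ := hf
  have key : ∀ n : ℕ, ∀ s, f s ≤ G.γ ^ n * B := by
    intro n
    induction n with
    | zero => intro s; simpa using (le_abs_self _).trans (hB s)
    | succ n ih =>
      intro s
      refine (h s).trans ?_
      rw [pow_succ', mul_assoc]
      refine mul_le_mul_of_nonneg_left ?_ G.γ_nonneg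
      calc G.trans π f s ≤ G.trans π (fun _ => G.γ ^ n * B) s :=
            trans_mono ⟨B, hB⟩ (Bdd.const _) ih s
        _ = G.γ ^ n * B := expect_const _ _
  have ht : Filter.Tendsto (fun n : ℕ => G.γ ^ n * B) Filter.atTop (nhds (0 * B)) :=
    (tendsto_pow_atTop_nhds_zero_of_lt_one G.γ_nonneg G.γ_lt_one).mul_const B
  rw [zero_mul] at ht
  exact ge_of_tendsto' ht fun n => key n s

/-- A bounded subsolution of the evaluation equation is below the solution. -/
theorem le_resolvent (hf : Bdd f) (hg : Bdd g) (h : ∀ s, g s ≤ f s + G.γ * G.trans π g s) (s : S) :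
    g s ≤ G.resolvent π f s := by
  have hr := bdd_resolvent (G := G) (π := π) hf
  have := nonpos_of_le_trans (G := G) (π := π) (hg.sub hr) (fun s => by
    rw [trans, expect_sub _ hg hr]
    have h1 := h s
    rw [resolvent_eq hf s]
    simp only [trans] at h1 ⊢
    linarith) s
  linarith

theorem resolvent_le (hf : Bdd f) (hg : Bdd g) (h : ∀ s, f s + G.γ * G.trans π g s ≤ g s) (s : S) :
    G.resolvent π f s ≤ g s := by
  have hr := bdd_resolvent (G := G) (π := π) hf
  have := nonpos_of_le_trans (G := G) (π := π) (hr.sub hg) (fun s => by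
    rw [trans, expect_sub _ hr hg]
    have h1 := h s
    rw [resolvent_eq hf s]
    simp only [trans] at h1 ⊢
    linarith) s
  linarith

/-- Uniqueness of bounded solutions. Linearity of the resolvent and the performance difference are
proved by checking this one-step equation instead of manipulating series. -/
theorem eq_resolvent (hf : Bdd f) (hg : Bdd g) (h : ∀ s, g s = f s + G.γ * G.trans π g s) (s : S) :
    g s = G.resolvent π f s :=
  le_antisymm (le_resolvent hf hg (fun s => (h s).le) s) (resolvent_le hf hg (fun s => (h s).ge) s)

theorem resolvent_mono (hf : Bdd f) (hg : Bdd g) (h : ∀ s, f s ≤ g s) (s : S) :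
    G.resolvent π f s ≤ G.resolvent π g s :=
  le_resolvent hg (bdd_resolvent hf) (fun s => by rw [resolvent_eq hf s]; linarith [h s]) s

theorem resolvent_add (hf : Bdd f) (hg : Bdd g) (s : S) :
    G.resolvent π (fun s => f s + g s) s = G.resolvent π f s + G.resolvent π g s := by
  have hF := bdd_resolvent (G := G) (π := π) hf
  have hH := bdd_resolvent (G := G) (π := π) hg
  refine (eq_resolvent (hf.add hg) (hF.add hH) (fun s => ?_) s).symm
  rw [trans, expect_add _ hF hH, resolvent_eq hf s, resolvent_eq hg s]
  simp only [trans]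
  ring

theorem resolvent_const_mul (c : ℝ) (hf : Bdd f) (s : S) :
    G.resolvent π (fun s => c * f s) s = c * G.resolvent π f s := by
  have hF := bdd_resolvent (G := G) (π := π) hf
  refine (eq_resolvent (hf.const_mul c) (hF.const_mul c) (fun s => ?_) s).symm
  rw [trans, expect_const_mul, resolvent_eq hf s]
  simp only [trans]
  ring

theorem resolvent_const (c : ℝ) (s : S) : G.resolvent π (fun _ => c) s = c / (1 - G.γ) := by
  refine (eq_resolvent (Bdd.const c) (Bdd.const (c / (1 - G.γ))) (fun s => ?_) s).symm
  rw [trans, expect_const]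
  have := (one_sub_pos (G := G)).ne'
  field_simp
  ring

theorem resolvent_nonneg (hf : Bdd f) (h : ∀ s, 0 ≤ f s) (s : S) : 0 ≤ G.resolvent π f s := by
  simpa [resolvent_const] using resolvent_mono (G := G) (π := π) (Bdd.const 0) hf h s

theorem self_le_resolvent (hf : Bdd f) (h : ∀ s, 0 ≤ f s) (s : S) : f s ≤ G.resolvent π f s := by
  rw [resolvent_eq hf s]
  have := mul_nonneg G.γ_nonneg (expect_nonneg (G.nextLaw π s)
    (resolvent_nonneg (G := G) (π := π) hf h))
  simp only [trans]
  linarith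

theorem abs_resolvent_le (hf : Bdd f) (s : S) :
    |G.resolvent π f s| ≤ G.resolvent π (fun s => |f s|) s := by
  rw [abs_le]
  constructor
  · have := resolvent_mono (G := G) (π := π) (hf.abs.const_mul (-1)) hf
      (fun s => by linarith [neg_abs_le (f s)]) s
    rw [resolvent_const_mul _ hf.abs] at this
    linarith
  · exact resolvent_mono hf hf.abs (fun s => le_abs_self _) s

/-- Jensen for the probability measure δ · resolvent, obtained from (f - c)² ≥ 0 with c the mean of
f under it. -/
theorem sq_resolvent_le (hf : Bdd f) (s : S) :
    (1 - G.γ) * G.resolvent π f s ^ 2 ≤ G.resolvent π (fun s => f s ^ 2) s := by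
  have hδ := one_sub_pos (G := G)
  set c := (1 - G.γ) * G.resolvent π f s with hc
  have h := resolvent_mono (G := G) (π := π) (hf.const_mul (2 * c))
    (hf.sq.add (Bdd.const (c ^ 2))) (fun s => by nlinarith [sq_nonneg (f s - c)]) s
  rw [resolvent_const_mul _ hf, resolvent_add hf.sq (Bdd.const _), resolvent_const] at h
  have h2 : c ^ 2 / (1 - G.γ) = (1 - G.γ) * G.resolvent π f s ^ 2 := by
    rw [hc]; field_simp
  rw [h2, hc] at h
  nlinarith

/-! ### Values as resolvents -/

theorem abs_r_le (i : Fin N) (s : S) (a : Fin N → Fin A) : |G.r i s a| ≤ 1 := by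
  have := G.r_mem i s a
  rw [abs_of_nonneg this.1]
  exact this.2

/-- Expected one-step reward of player `i`. -/
def meanReward (G : Game N A S) (π : Policy N A S) (i : Fin N) (s : S) : ℝ :=
  expect (jointAct π s) (G.r i s)

theorem bdd_meanReward (i : Fin N) : Bdd (G.meanReward π i) :=
  Bdd.expect (abs_r_le i) _

theorem expect_step (x : S × (Fin N → Fin A)) {g : S × (Fin N → Fin A) → ℝ} (hg : Bdd g) :
    expect (G.step π x) g
      = expect (G.P x.1 x.2) fun s => expect (jointAct π s) fun a => g (s, a) :=
  expect_withAct _ _ hg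

/-- Averaging out the action at the last step reduces the state-action chain to powers of `trans`;
hence values become resolvents. -/
theorem expect_saLaw_withAct (μ : PMF S) (t : ℕ) :
    ∀ {g : S × (Fin N → Fin A) → ℝ}, Bdd g →
      expect (G.saLaw π (withAct π μ) t) g
        = expect μ ((G.trans π)^[t] fun s => expect (jointAct π s) fun a => g (s, a)) := by
  induction t with
  | zero => intro g hg; exact expect_withAct _ _ hg
  | succ t ih =>
    intro g hg
    obtain ⟨B, hB⟩ := hg
    rw [saLaw, expect_bind _ _ ⟨B, hB⟩, ih (Bdd.expect (fun _ => hB) _),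
      Function.iterate_succ_apply]
    congr 2
    funext s
    rw [trans_eq _ (Bdd.expect (fun s a => hB (s, a)) _)]
    simp only [expect_step _ ⟨B, hB⟩]

theorem expect_saLaw_pure (s : S) (a : Fin N → Fin A) (t : ℕ) {g : S × (Fin N → Fin A) → ℝ}
    (hg : Bdd g) :
    expect (G.saLaw π (PMF.pure (s, a)) (t + 1)) g
      = expect (G.P s a) ((G.trans π)^[t] fun s => expect (jointAct π s) fun a => g (s, a)) := by
  have h : ∀ t, G.saLaw π (PMF.pure (s, a)) (t + 1) = G.saLaw π (withAct π (G.P s a)) t := by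
    intro t
    induction t with
    | zero => simp [saLaw, step]
    | succ t ih => rw [saLaw, ih, ← saLaw]
  rw [h, expect_saLaw_withAct _ _ hg]

theorem bdd_r (i : Fin N) : Bdd fun x : S × (Fin N → Fin A) => G.r i x.1 x.2 :=
  ⟨1, fun _ => abs_r_le i _ _⟩

theorem V_eq (i : Fin N) (s : S) : G.V π i s = G.resolvent π (G.meanReward π i) s := by
  rw [V, discReward, resolvent]
  refine tsum_congr fun t => ?_
  rw [expect_saLaw_withAct _ _ (bdd_r i), expect_pure]
  rfl

theorem V_eq_resolvent : G.V π = fun i => G.resolvent π (G.meanReward π i) := by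
  funext i s
  exact V_eq i s

theorem bdd_V (i : Fin N) : Bdd (G.V π i) := by
  rw [V_eq_resolvent]
  exact bdd_resolvent (bdd_meanReward i)

theorem Q_eq (i : Fin N) (s : S) (a : Fin N → Fin A) :
    G.Q π i s a = G.r i s a + G.γ * expect (G.P s a) (G.V π i) := by
  have hs : Summable fun t : ℕ => G.γ ^ t *
      expect (G.saLaw π (PMF.pure (s, a)) t) fun x => G.r i x.1 x.2 := by
    refine Summable.of_norm_bounded (summable_bound (G := G) 1) fun t => ?_
    rw [Real.norm_eq_abs, abs_mul, abs_of_nonneg (pow_nonneg G.γ_nonneg t), mul_comm]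
    exact mul_le_mul_of_nonneg_right (abs_expect_le _ fun _ => abs_r_le i _ _)
      (pow_nonneg G.γ_nonneg t)
  rw [Q, discReward, hs.tsum_eq_zero_add, V_eq_resolvent, expect_resolvent _ (bdd_meanReward i),
    ← tsum_mul_left]
  congr 1
  · simp [saLaw, expect_pure]
  · refine tsum_congr fun t => ?_
    rw [expect_saLaw_pure _ _ _ (bdd_r i), pow_succ', mul_assoc]
    rfl

theorem V_bellman (i : Fin N) (s : S) :
    G.V π i s = expect (jointAct π s) (G.Q π i s) := by
  have hV := bdd_V (G := G) (π := π) i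
  have h1 : (G.Q π i s) = fun a => G.r i s a + G.γ * expect (G.P s a) (G.V π i) :=
    funext (Q_eq i s)
  rw [h1, expect_add _ (Bdd.of_finite _) (Bdd.of_finite _), expect_const_mul, ← trans_eq _ hV,
    V_eq_resolvent]
  exact resolvent_eq (bdd_meanReward i) s

theorem V_nonneg (i : Fin N) (s : S) : 0 ≤ G.V π i s := by
  rw [V_eq]
  exact resolvent_nonneg (bdd_meanReward i)
    (fun s => expect_nonneg _ fun a => (G.r_mem i s a).1) s

theorem V_le (i : Fin N) (s : S) : G.V π i s ≤ 1 / (1 - G.γ) := by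
  rw [V_eq, ← resolvent_const (G := G) (π := π) 1 s]
  refine resolvent_mono (bdd_meanReward i) (Bdd.const 1) (fun s => ?_) s
  exact (le_abs_self _).trans (abs_expect_le _ (abs_r_le i s))

theorem Q_mem (i : Fin N) (s : S) (a : Fin N → Fin A) :
    0 ≤ G.Q π i s a ∧ G.Q π i s a ≤ 1 / (1 - G.γ) := by
  have hV := bdd_V (G := G) (π := π) i
  have hδ := one_sub_pos (G := G)
  rw [Q_eq]
  constructor
  · exact add_nonneg (G.r_mem i s a).1 (mul_nonneg G.γ_nonneg (expect_nonneg _ (V_nonneg i)))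
  · have h := expect_mono (G.P s a) hV (Bdd.const (1 / (1 - G.γ))) (V_le i)
    rw [expect_const] at h
    have h2 := mul_le_mul_of_nonneg_left h G.γ_nonneg
    have h3 : 1 + G.γ * (1 / (1 - G.γ)) = 1 / (1 - G.γ) := by field_simp; ring
    linarith [(G.r_mem i s a).2]

theorem abs_Q_le (i : Fin N) (s : S) (a : Fin N → Fin A) : |G.Q π i s a| ≤ 1 / (1 - G.γ) := by
  rw [abs_of_nonneg (Q_mem i s a).1]
  exact (Q_mem i s a).2

/-- Performance difference: the value difference is the discounted sum, under the new policy, of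
the advantages. -/
theorem V_sub_V (π' π : Policy N A S) (i : Fin N) (s : S) :
    G.V π' i s - G.V π i s = G.resolvent π'
      (fun s => expect (jointAct π' s) (G.Q π i s) - expect (jointAct π s) (G.Q π i s)) s := by
  have hV := bdd_V (G := G) (π := π) i
  have hV' := bdd_V (G := G) (π := π') i
  refine eq_resolvent (f := fun s => expect (jointAct π' s) (G.Q π i s) -
    expect (jointAct π s) (G.Q π i s)) ((Bdd.expect (abs_Q_le i) _).sub
    (Bdd.expect (abs_Q_le i) _)) (hV'.sub hV) (fun s => ?_) s
  have h1 : (G.Q π i s) = fun a => G.r i s a + G.γ * expect (G.P s a) (G.V π i) :=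
    funext (Q_eq i s)
  have h2 : expect (jointAct π' s) (G.Q π i s)
      = G.meanReward π' i s + G.γ * G.trans π' (G.V π i) s := by
    rw [h1, expect_add _ (Bdd.of_finite _) (Bdd.of_finite _), expect_const_mul, ← trans_eq _ hV]
    rfl
  have h3 : G.V π' i s = G.meanReward π' i s + G.γ * G.trans π' (G.V π' i) s := by
    rw [V_eq_resolvent]
    exact resolvent_eq (bdd_meanReward i) s
  rw [h2, ← V_bellman, h3, trans, trans, trans, expect_sub _ hV' hV]
  ring

/-! ### Visitation -/

/-- The visitation measure and δ · resolvent are the same functional on bounded nonnegative f. In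
`ℝ≥0∞` the sums over states and times can be exchanged freely. -/
theorem ofReal_resolvent (hf : Bdd f) (h0 : ∀ s, 0 ≤ f s) (s₀ : S) :
    ∑' s, G.visitFrom π s₀ s * ENNReal.ofReal (f s)
      = ENNReal.ofReal ((1 - G.γ) * G.resolvent π f s₀) := by
  have hT : ∀ t, ∑' s, ((G.saLaw π (withAct π (PMF.pure s₀)) t).map Prod.fst) s *
      ENNReal.ofReal (f s) = ENNReal.ofReal ((G.trans π)^[t] f s₀) := by
    intro t
    rw [← ofReal_expect _ hf h0, expect_map _ _ hf, expect_saLaw_withAct _ _ (hf.comp _),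
      expect_pure]
    simp only [expect_const]
  have hn : ∀ t s, 0 ≤ (G.trans π)^[t] f s := by
    intro t
    induction t with
    | zero => exact h0
    | succ t ih =>
      intro s
      rw [Function.iterate_succ_apply']
      exact expect_nonneg _ ih
  simp only [visitFrom, mul_assoc, ENNReal.tsum_mul_left, ← ENNReal.tsum_mul_right]
  rw [ENNReal.tsum_comm]
  simp only [ENNReal.tsum_mul_left, hT]
  rw [ENNReal.ofReal_mul one_sub_pos.le, resolvent, ENNReal.ofReal_tsum_of_nonneg
    (fun t => mul_nonneg (pow_nonneg G.γ_nonneg t) (hn t s₀)) (summable_resolvent hf s₀)]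
  simp only [ENNReal.ofReal_mul (pow_nonneg G.γ_nonneg _)]

theorem tsum_visit (hf : Bdd f) (h0 : ∀ s, 0 ≤ f s) :
    ∑' s, G.visit π s * ENNReal.ofReal (f s)
      = ENNReal.ofReal ((1 - G.γ) * expect G.ρ (G.resolvent π f)) := by
  have hr := bdd_resolvent (G := G) (π := π) hf
  have hr0 := resolvent_nonneg (G := G) (π := π) hf h0
  simp only [visit, ← ENNReal.tsum_mul_right]
  rw [ENNReal.tsum_comm]
  simp only [mul_assoc, ENNReal.tsum_mul_left, ofReal_resolvent hf h0]
  rw [← expect_const_mul, ofReal_expect _ (hr.const_mul _)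
    (fun s => mul_nonneg one_sub_pos.le (hr0 s))]

theorem visit_ne_top (π : Policy N A S) (s : S) : G.visit π s ≠ ⊤ := by
  have h := tsum_visit (G := G) (π := π) (Bdd.const 1) (fun _ => zero_le_one)
  simp only [ENNReal.ofReal_one, mul_one] at h
  exact ENNReal.ne_top_of_tsum_ne_top (by rw [h]; exact ENNReal.ofReal_ne_top) s

theorem visit_tsum_toReal (hf : Bdd f) (h0 : ∀ s, 0 ≤ f s) :
    ∑' s, (G.visit π s).toReal * f s = (1 - G.γ) * expect G.ρ (G.resolvent π f) := by
  have h := congrArg ENNReal.toReal (tsum_visit (G := G) (π := π) hf h0)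
  rw [ENNReal.tsum_toReal_eq fun s => ENNReal.mul_ne_top (visit_ne_top π s) ENNReal.ofReal_ne_top,
    ENNReal.toReal_ofReal (mul_nonneg one_sub_pos.le
      (expect_nonneg _ (resolvent_nonneg hf h0)))] at h
  rw [← h]
  refine tsum_congr fun s => ?_
  rw [ENNReal.toReal_mul, ENNReal.toReal_ofReal (h0 s)]

theorem visit_le (hk : G.kappa ≠ ⊤) (π : Policy N A S) (s : S) :
    G.visit π s ≤ G.kappa * G.ρ s := by
  have h : G.visit π s / G.ρ s ≤ G.kappa :=
    le_iSup_of_le (f := fun π => ⨆ s, G.visit π s / G.ρ s) π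
      (le_iSup (fun s => G.visit π s / G.ρ s) s)
  rcases eq_or_ne (G.ρ s) 0 with h0 | h0
  -- Where ρ vanishes, a positive visitation would make the quotient infinite, against finiteness of
  -- κ.
  · rcases eq_or_ne (G.visit π s) 0 with h1 | h1
    · simp [h1]
    · rw [h0, ENNReal.div_zero h1, top_le_iff] at h
      exact absurd h hk
  · exact (ENNReal.div_le_iff h0 (G.ρ.apply_ne_top s)).1 h

/-- The change of measure through which κ enters all later estimates: any policy's visitation
measure is at most κ times ρ. -/
theorem expect_resolvent_le (hk : G.kappa ≠ ⊤) (π : Policy N A S) (hf : Bdd f)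
    (h0 : ∀ s, 0 ≤ f s) :
    (1 - G.γ) * expect G.ρ (G.resolvent π f) ≤ G.kappa.toReal * expect G.ρ f := by
  have hp : 0 ≤ G.kappa.toReal * expect G.ρ f :=
    mul_nonneg ENNReal.toReal_nonneg (expect_nonneg _ h0)
  rw [← ENNReal.ofReal_le_ofReal_iff hp, ← tsum_visit hf h0, ENNReal.ofReal_mul
    ENNReal.toReal_nonneg, ENNReal.ofReal_toReal hk, ofReal_expect _ hf h0, ← ENNReal.tsum_mul_left]
  refine ENNReal.tsum_le_tsum fun s => ?_
  rw [← mul_assoc]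
  exact mul_le_mul_left (visit_le hk π s) _

theorem one_le_kappa (hk : G.kappa ≠ ⊤) (π : Policy N A S) : 1 ≤ G.kappa.toReal := by
  have h := expect_resolvent_le hk π (Bdd.const 1) (fun _ => zero_le_one)
  have h1 : G.resolvent π (fun _ => 1) = fun _ => 1 / (1 - G.γ) := funext (resolvent_const 1)
  rw [h1, expect_const, expect_const, mul_one_div_cancel one_sub_pos.ne', mul_one] at h
  exact h

end Game

/-! ### Changing the policies of some players -/

/-- The sum of `g` over the joint actions in which player `i` plays `b`, weighted by the
probabilities of the other actions. -/
def marginal (π : Policy N A S) (i : Fin N) (s : S) (g : (Fin N → Fin A) → ℝ) (b : Fin A) : ℝ :=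
  ∑ a : Fin N → Fin A with a i = b, (∏ j ∈ Finset.univ.erase i, (π j s).1 (a j)) * g a

theorem expect_update (π : Policy N A S) (i : Fin N) (p : PlayerPolicy A S) (s : S)
    (g : (Fin N → Fin A) → ℝ) :
    expect (jointAct (Function.update π i p) s) g = ∑ b, (p s).1 b * marginal π i s g b := by
  rw [expect_jointAct, ← Finset.sum_fiberwise _ (fun a : Fin N → Fin A => a i)]
  refine Finset.sum_congr rfl fun b _ => ?_
  rw [marginal, Finset.mul_sum]
  refine Finset.sum_congr rfl fun a ha => ?_
  rw [Finset.mem_filter] at ha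
  rw [← Finset.mul_prod_erase _ _ (Finset.mem_univ i), Function.update_self, ha.2, mul_assoc]
  congr 2
  refine Finset.prod_congr rfl fun j hj => ?_
  rw [Function.update_of_ne (Finset.ne_of_mem_erase hj)]

theorem expect_eq_marginal (π : Policy N A S) (i : Fin N) (s : S) (g : (Fin N → Fin A) → ℝ) :
    expect (jointAct π s) g = ∑ b, (π i s).1 b * marginal π i s g b := by
  rw [← expect_update, Function.update_eq_self]

/-- The policy of one player that always plays `b`. -/
def purePolicy (b : Fin A) : PlayerPolicy A S := fun _ => ⟨Pi.single b 1, single_mem_stdSimplex ℝ b⟩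

theorem expect_update_pure (π : Policy N A S) (i : Fin N) (b : Fin A) (s : S)
    (g : (Fin N → Fin A) → ℝ) :
    expect (jointAct (Function.update π i (purePolicy b)) s) g = marginal π i s g b := by
  rw [expect_update]
  simp [purePolicy, Pi.single_apply]

theorem abs_marginal_le (π : Policy N A S) (i : Fin N) (s : S) {g : (Fin N → Fin A) → ℝ} {B : ℝ}
    (hg : ∀ a, |g a| ≤ B) (b : Fin A) : |marginal π i s g b| ≤ B := by
  rw [← expect_update_pure]
  exact abs_expect_le _ hg

/-- `ℓ¹` distance of two policies of a player in a state. -/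
def l1Dist (p q : PlayerPolicy A S) (s : S) : ℝ := ∑ b, |(p s).1 b - (q s).1 b|

/-- Squared Euclidean distance of two policies of a player in a state. -/
def sqDist (p q : PlayerPolicy A S) (s : S) : ℝ := ∑ b, ((p s).1 b - (q s).1 b) ^ 2

theorem l1Dist_nonneg (p q : PlayerPolicy A S) (s : S) : 0 ≤ l1Dist p q s :=
  Finset.sum_nonneg fun _ _ => abs_nonneg _

theorem sqDist_nonneg (p q : PlayerPolicy A S) (s : S) : 0 ≤ sqDist p q s :=
  Finset.sum_nonneg fun _ _ => sq_nonneg _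

theorem bdd_policy (p : PlayerPolicy A S) (b : Fin A) : Bdd fun s => (p s).1 b := by
  refine ⟨1, fun s => ?_⟩
  rw [abs_of_nonneg ((p s).2.1 b), ← (p s).2.2]
  exact Finset.single_le_sum (fun c _ => (p s).2.1 c) (Finset.mem_univ b)

theorem bdd_l1Dist (p q : PlayerPolicy A S) : Bdd (l1Dist p q) :=
  Bdd.sum _ fun b _ => ((bdd_policy p b).sub (bdd_policy q b)).abs

theorem bdd_sqDist (p q : PlayerPolicy A S) : Bdd (sqDist p q) :=
  Bdd.sum _ fun b _ => ((bdd_policy p b).sub (bdd_policy q b)).sq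

theorem sq_l1Dist_le (p q : PlayerPolicy A S) (s : S) :
    l1Dist p q s ^ 2 ≤ A * sqDist p q s := by
  have := sq_sum_le_card_mul_sum_sq (s := Finset.univ) (f := fun b => |(p s).1 b - (q s).1 b|)
  simpa [l1Dist, sqDist, sq_abs] using this

/-- The first `k` players play according to `π'`, the others according to `π`. -/
def mix (π π' : Policy N A S) (k : ℕ) : Policy N A S := fun j => if j.val < k then π' j else π j

theorem mix_zero (π π' : Policy N A S) : mix π π' 0 = π := by
  funext j
  simp [mix]

theorem mix_last (π π' : Policy N A S) : mix π π' N = π' := by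
  funext j
  simp [mix]

theorem mix_succ (π π' : Policy N A S) (i : Fin N) :
    mix π π' (i.val + 1) = Function.update (mix π π' i.val) i (π' i) := by
  funext j
  rcases eq_or_ne j i with rfl | h
  · simp [mix]
  · have h' : j.val ≠ i.val := fun h' => h (Fin.ext h')
    have : j.val < i.val + 1 ↔ j.val < i.val := by omega
    simp [mix, h, this]

theorem mix_at (π π' : Policy N A S) (i : Fin N) : mix π π' i.val i = π i := by
  simp [mix]

theorem sum_telescope (h : ℕ → ℝ) : ∑ i : Fin N, (h (i.val + 1) - h i.val) = h N - h 0 := by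
  rw [Fin.sum_univ_eq_sum_range (fun k => h (k + 1) - h k), Finset.sum_range_sub]

theorem abs_sum_mul_le {c y : Fin A → ℝ} {B : ℝ} (hy : ∀ b, |y b| ≤ B) :
    |∑ b, c b * y b| ≤ (∑ b, |c b|) * B := by
  refine (Finset.abs_sum_le_sum_abs _ _).trans ?_
  rw [Finset.sum_mul]
  refine Finset.sum_le_sum fun b _ => ?_
  rw [abs_mul]
  exact mul_le_mul_of_nonneg_left (hy b) (abs_nonneg _)

/-- Hybrid argument: along `mix` one player changes at a time, and each change costs at most the ℓ¹
distance of her two policies times B. -/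
theorem abs_expect_jointAct_sub_le (π π' : Policy N A S) (s : S) {g : (Fin N → Fin A) → ℝ} {B : ℝ}
    (hg : ∀ a, |g a| ≤ B) :
    |expect (jointAct π' s) g - expect (jointAct π s) g| ≤ (∑ j, l1Dist (π' j) (π j) s) * B := by
  have h := sum_telescope (N := N) fun k => expect (jointAct (mix π π' k) s) g
  simp only [mix_last, mix_zero] at h
  rw [← h, Finset.sum_mul]
  refine (Finset.abs_sum_le_sum_abs _ _).trans (Finset.sum_le_sum fun i _ => ?_)
  rw [mix_succ, expect_update, expect_eq_marginal _ i, mix_at, ← Finset.sum_sub_distrib]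
  simp only [← sub_mul]
  exact abs_sum_mul_le fun b => abs_marginal_le _ _ _ hg b

/-- AM-GM with a free weight, chosen afresh at each use to balance the resulting terms. -/
theorem mul_le_weighted {α : ℝ} (hα : 0 < α) (x y : ℝ) :
    x * y ≤ α / 2 * x ^ 2 + 1 / (2 * α) * y ^ 2 := by
  have : α / 2 * x ^ 2 + 1 / (2 * α) * y ^ 2 - x * y = (α * x - y) ^ 2 / (2 * α) := by
    field_simp
    ring
  have h2 : 0 ≤ (α * x - y) ^ 2 / (2 * α) := by positivity
  linarith

/-! ### Sensitivity of values and averaged action values to the policy -/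

namespace Game
variable {G : Game N A S}

theorem Qbar_eq (π : Policy N A S) (i : Fin N) (s : S) (b : Fin A) :
    G.Qbar π i s b = marginal π i s (G.Q π i s) b := rfl

theorem abs_Qbar_le (π : Policy N A S) (i : Fin N) (s : S) (b : Fin A) :
    |G.Qbar π i s b| ≤ 1 / (1 - G.γ) :=
  abs_marginal_le _ _ _ (abs_Q_le i s) b

theorem bdd_Qbar (π : Policy N A S) (i : Fin N) (b : Fin A) : Bdd fun s => G.Qbar π i s b :=
  ⟨_, fun s => abs_Qbar_le π i s b⟩

/-- Performance difference for a unilateral change of policy. -/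
theorem V_update_sub (π : Policy N A S) (i : Fin N) (p : PlayerPolicy A S) (s : S) :
    G.V (Function.update π i p) i s - G.V π i s
      = G.resolvent (Function.update π i p)
          (fun s => ∑ b, ((p s).1 b - (π i s).1 b) * G.Qbar π i s b) s := by
  rw [V_sub_V]
  congr 1
  funext s
  rw [expect_update, expect_eq_marginal π i, ← Finset.sum_sub_distrib]
  simp only [← sub_mul, Qbar_eq]

theorem abs_V_sub_le (π' π : Policy N A S) (i : Fin N) {F : S → ℝ} (hF : Bdd F)
    (hd : ∀ s, ∑ j, l1Dist (π' j) (π j) s ≤ F s) (s : S) :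
    |G.V π' i s - G.V π i s| ≤ 1 / (1 - G.γ) * G.resolvent π' F s := by
  have hb : Bdd fun s =>
      expect (jointAct π' s) (G.Q π i s) - expect (jointAct π s) (G.Q π i s) :=
    (Bdd.expect (abs_Q_le i) _).sub (Bdd.expect (abs_Q_le i) _)
  rw [V_sub_V, ← resolvent_const_mul _ hF]
  refine (abs_resolvent_le hb s).trans (resolvent_mono hb.abs (hF.const_mul _) (fun s => ?_) s)
  refine (abs_expect_jointAct_sub_le π π' s (abs_Q_le i s)).trans ?_
  rw [mul_comm]
  exact mul_le_mul_of_nonneg_left (hd s) (one_div_nonneg.2 one_sub_pos.le)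

/-- Two effects are separated: the other players' immediate actions are averaged differently (the
term in F), and the continuation values differ (the term in the resolvent). Forcing player i to play
b writes both averages as expectations under genuine joint policies. -/
theorem abs_Qbar_sub_le (π' π : Policy N A S) (i : Fin N) {F : S → ℝ} (hF : Bdd F)
    (hd : ∀ s, ∑ j, l1Dist (π' j) (π j) s ≤ F s) (s : S) (b : Fin A) :
    |G.Qbar π' i s b - G.Qbar π i s b| ≤ 1 / (1 - G.γ) * F s + G.γ / (1 - G.γ) *
      marginal π' i s (fun a => expect (G.P s a) (G.resolvent π' F)) b := by
  have hδ := one_sub_pos (G := G)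
  have hr := bdd_resolvent (G := G) (π := π') hF
  set u := G.resolvent π' F with hu
  set τ' := Function.update π' i (purePolicy b) with hτ'
  set τ := Function.update π i (purePolicy b) with hτ
  have hQ : ∀ a, |G.Q π' i s a - G.Q π i s a|
      ≤ G.γ / (1 - G.γ) * expect (G.P s a) u := by
    intro a
    rw [Q_eq, Q_eq, add_sub_add_left_eq_sub, ← mul_sub, ← expect_sub _ (bdd_V i) (bdd_V i),
      abs_mul, abs_of_nonneg G.γ_nonneg, div_mul_eq_mul_div, mul_div_assoc]
    refine mul_le_mul_of_nonneg_left ?_ G.γ_nonneg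
    refine (abs_expect_le_expect _ ((bdd_V i).sub (bdd_V i))).trans ?_
    rw [div_eq_inv_mul, ← one_div, ← expect_const_mul]
    exact expect_mono _ ((bdd_V i).sub (bdd_V i)).abs (hr.const_mul _)
      (abs_V_sub_le π' π i hF hd)
  have h1 : |expect (jointAct τ' s) (G.Q π' i s) - expect (jointAct τ' s) (G.Q π i s)|
      ≤ G.γ / (1 - G.γ) * marginal π' i s (fun a => expect (G.P s a) u) b := by
    rw [← expect_sub _ (Bdd.of_finite _) (Bdd.of_finite _)]
    refine (abs_expect_le_expect _ (Bdd.of_finite _)).trans ?_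
    rw [← expect_update_pure, ← expect_const_mul]
    exact expect_mono _ (Bdd.of_finite _) (Bdd.of_finite _) hQ
  have h2 : |expect (jointAct τ' s) (G.Q π i s) - expect (jointAct τ s) (G.Q π i s)|
      ≤ 1 / (1 - G.γ) * F s := by
    refine (abs_expect_jointAct_sub_le τ τ' s (abs_Q_le i s)).trans ?_
    rw [mul_comm]
    refine mul_le_mul_of_nonneg_left (le_trans (Finset.sum_le_sum fun j _ => ?_) (hd s))
      (one_div_nonneg.2 hδ.le)
    -- In both auxiliary policies player i plays b, so her own distance contributes nothing.
    rcases eq_or_ne j i with rfl | h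
    · simp only [hτ, hτ', Function.update_self]
      simpa [l1Dist] using l1Dist_nonneg (π' j) (π j) s
    · simp only [hτ, hτ', Function.update_of_ne h, le_refl]
  rw [Qbar_eq, Qbar_eq, ← expect_update_pure, ← expect_update_pure]
  calc _ = |(expect (jointAct τ' s) (G.Q π' i s) - expect (jointAct τ' s) (G.Q π i s)) +
        (expect (jointAct τ' s) (G.Q π i s) - expect (jointAct τ s) (G.Q π i s))| := by
        congr 1; ring
    _ ≤ _ := (abs_add_le _ _).trans (by linarith)

/-- One step of policy improvement of a single player dominates every deviation of that player. -/
theorem exists_marginal_le (hA : 1 ≤ A) (hk : G.kappa ≠ ⊤) (σ : Policy N A S) (i : Fin N)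
    {f : S → ℝ} (hf : Bdd f) (h0 : ∀ s, 0 ≤ f s) :
    ∃ M : S → ℝ, Bdd M ∧ (∀ s, 0 ≤ M s) ∧
      (∀ s b, marginal σ i s (fun a => expect (G.P s a) (G.resolvent σ f)) b ≤ M s) ∧
      G.γ * ((1 - G.γ) * expect G.ρ M) ≤ G.kappa.toReal * expect G.ρ f := by
  have hv := bdd_resolvent (G := G) (π := σ) hf
  have hv0 := resolvent_nonneg (G := G) (π := σ) hf h0
  set v := G.resolvent σ f with hvdef
  have : Nonempty (Fin A) := ⟨⟨0, hA⟩⟩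
  choose best hbest using fun s => Finite.exists_max
    (marginal σ i s fun a => expect (G.P s a) v)
  -- Playing the maximizing action in every state replaces the separate deviations b by a single
  -- policy m, whose visitation κ controls.
  set p : PlayerPolicy A S := fun s => purePolicy (best s) s with hp
  set m := Function.update σ i p with hm
  have hT : ∀ s, G.trans m v s = marginal σ i s (fun a => expect (G.P s a) v) (best s) := by
    intro s
    rw [trans_eq _ hv, hm, expect_update]
    simp [hp, purePolicy, Pi.single_apply]
  have hσ : ∀ s, G.trans σ v s ≤ G.trans m v s := by
    intro s
    rw [hT, trans_eq _ hv, expect_eq_marginal σ i]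
    calc _ ≤ ∑ b, (σ i s).1 b * marginal σ i s (fun a => expect (G.P s a) v) (best s) :=
          Finset.sum_le_sum fun b _ => mul_le_mul_of_nonneg_left (hbest s b) ((σ i s).2.1 b)
      _ = _ := by rw [← Finset.sum_mul, (σ i s).2.2, one_mul]
  -- v solves the equation for σ, and its transition term does not decrease under m, so v is a
  -- subsolution for m.
  have hvm : ∀ s, v s ≤ G.resolvent m f s := le_resolvent hf hv fun s => by
    rw [hvdef, resolvent_eq hf s, ← hvdef]
    have := mul_le_mul_of_nonneg_left (hσ s) G.γ_nonneg
    linarith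
  have hrm := bdd_resolvent (G := G) (π := m) hf
  refine ⟨G.trans m v, bdd_trans hv, fun s => expect_nonneg _ hv0, fun s b => ?_, ?_⟩
  · rw [hT]; exact hbest s b
  -- γM is at most the part of the m-resolvent of f after time zero, so one change of measure
  -- suffices for it.
  · have h1 : G.γ * expect G.ρ (G.trans m v) ≤ expect G.ρ (G.resolvent m f) := by
      rw [← expect_const_mul]
      refine expect_mono _ ((bdd_trans hv).const_mul _) hrm fun s => ?_
      rw [resolvent_eq hf s]
      have := mul_le_mul_of_nonneg_left (trans_mono (G := G) (π := m) hv hrm hvm s) G.γ_nonneg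
      linarith [h0 s]
    have h2 := expect_resolvent_le hk m hf h0
    have h3 := mul_le_mul_of_nonneg_left h1 (one_sub_pos (G := G)).le
    linarith

end Game

/-! ### Discounted sums from ρ and the second-order interaction bound -/

namespace Game

/-- Expected discounted sum of `f` under `π` from the initial distribution. -/
def occ (G : Game N A S) (π : Policy N A S) (f : S → ℝ) : ℝ := expect G.ρ (G.resolvent π f)

variable {G : Game N A S} {π : Policy N A S} {f g : S → ℝ}

theorem occ_add (hf : Bdd f) (hg : Bdd g) :
    G.occ π (fun s => f s + g s) = G.occ π f + G.occ π g := by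
  rw [occ, occ, occ, ← expect_add _ (bdd_resolvent hf) (bdd_resolvent hg)]
  exact congrArg _ (funext (resolvent_add hf hg))

theorem occ_const_mul (c : ℝ) (hf : Bdd f) : G.occ π (fun s => c * f s) = c * G.occ π f := by
  rw [occ, occ, ← expect_const_mul]
  exact congrArg _ (funext (resolvent_const_mul c hf))

theorem occ_const (c : ℝ) : G.occ π (fun _ => c) = c / (1 - G.γ) := by
  rw [occ, funext (resolvent_const c), expect_const]

theorem occ_mono (hf : Bdd f) (hg : Bdd g) (h : ∀ s, f s ≤ g s) : G.occ π f ≤ G.occ π g :=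
  expect_mono _ (bdd_resolvent hf) (bdd_resolvent hg) (resolvent_mono hf hg h)

theorem expect_le_occ (hf : Bdd f) (h0 : ∀ s, 0 ≤ f s) : expect G.ρ f ≤ G.occ π f :=
  expect_mono _ hf (bdd_resolvent hf) (self_le_resolvent hf h0)

theorem occ_le (hk : G.kappa ≠ ⊤) (hf : Bdd f) (h0 : ∀ s, 0 ≤ f s) :
    G.occ π f ≤ G.kappa.toReal / (1 - G.γ) * expect G.ρ f := by
  rw [div_mul_eq_mul_div, le_div_iff₀ one_sub_pos, mul_comm]
  exact expect_resolvent_le hk π hf h0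

theorem one_sub_le_one : 1 - G.γ ≤ 1 := by linarith [G.γ_nonneg]

/-- Jensen three times: over the joint action, over the transition, and along the discounted
trajectory. -/
theorem sq_marginal_resolvent_le (σ : Policy N A S) (i : Fin N) (hf : Bdd f) (s : S) (b : Fin A) :
    (1 - G.γ) * marginal σ i s (fun a => expect (G.P s a) (G.resolvent σ f)) b ^ 2
      ≤ marginal σ i s (fun a => expect (G.P s a) (G.resolvent σ fun s => f s ^ 2)) b := by
  have hr := bdd_resolvent (G := G) (π := σ) hf
  rw [← expect_update_pure, ← expect_update_pure]
  refine (mul_le_mul_of_nonneg_left (sq_expect_le _ (Bdd.of_finite _)) one_sub_pos.le).trans ?_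
  rw [← expect_const_mul]
  refine expect_mono _ (Bdd.of_finite _) (Bdd.of_finite _) fun a => ?_
  refine (mul_le_mul_of_nonneg_left (sq_expect_le _ hr) one_sub_pos.le).trans ?_
  rw [← expect_const_mul]
  exact expect_mono _ (hr.sq.const_mul _) (bdd_resolvent hf.sq) (sq_resolvent_le hf)

theorem sq_sum_l1Dist_le (π π' : Policy N A S) (s : S) :
    (∑ j, l1Dist (π' j) (π j) s) ^ 2 ≤ N * A * ∑ j, sqDist (π' j) (π j) s := by
  have h := sq_sum_le_card_mul_sum_sq (s := Finset.univ) (f := fun j => l1Dist (π' j) (π j) s)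
  rw [Finset.card_univ, Fintype.card_fin] at h
  refine h.trans ?_
  rw [mul_assoc]
  refine mul_le_mul_of_nonneg_left ?_ (Nat.cast_nonneg N)
  rw [Finset.mul_sum]
  exact Finset.sum_le_sum fun j _ => sq_l1Dist_le _ _ _

/-- The change of the averaged action values of player `i` caused by the other players is of second
order in the size of the policy update. -/
theorem occ_interaction_le (hA : 1 ≤ A) (hk : G.kappa ≠ ⊤) (π π' : Policy N A S) (i : Fin N) :
    G.occ (mix π π' (i.val + 1)) (fun s => |∑ b, ((π' i s).1 b - (π i s).1 b) *
        (G.Qbar (mix π π' i.val) i s b - G.Qbar π i s b)|)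
      ≤ G.kappa.toReal * N * A / (1 - G.γ) ^ 3 *
          G.occ (mix π π' (i.val + 1)) (sqDist (π' i) (π i)) +
        G.kappa.toReal * A / (1 - G.γ) ^ 2 *
          expect G.ρ (fun s => ∑ j, sqDist (π' j) (π j) s) := by
  set σ := mix π π' i.val with hσ
  set τ := mix π π' (i.val + 1) with hτ
  set κ := G.kappa.toReal with hκdef
  have hκ : 1 ≤ κ := one_le_kappa hk π
  have hN : (1 : ℝ) ≤ N := by exact_mod_cast i.pos
  set δ := 1 - G.γ with hδdef
  have hδ : 0 < δ := one_sub_pos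
  have hδ1 : δ ≤ 1 := one_sub_le_one
  have hγ0 := G.γ_nonneg
  have hγ1 := G.γ_lt_one.le
  set F : S → ℝ := fun s => ∑ j, l1Dist (π' j) (π j) s with hFdef
  have hF : Bdd F := Bdd.sum _ fun j _ => bdd_l1Dist _ _
  have hF0 : ∀ s, 0 ≤ F s := fun s => Finset.sum_nonneg fun j _ => l1Dist_nonneg _ _ _
  set n : S → ℝ := fun s => ∑ j, sqDist (π' j) (π j) s with hndef
  have hn : Bdd n := Bdd.sum _ fun j _ => bdd_sqDist _ _
  have hd : ∀ s, ∑ j, l1Dist (σ j) (π j) s ≤ F s := fun s => Finset.sum_le_sum fun j _ => by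
    simp only [hσ, mix]
    split_ifs
    · exact le_rfl
    · simpa [l1Dist] using l1Dist_nonneg (π' j) (π j) s
  obtain ⟨M, hM, hM0, hMle, hMρ⟩ := exists_marginal_le hA hk σ i hF.sq fun s => sq_nonneg _
  -- This weight makes the immediate and the continuation parts contribute equally, κ/(2Nδ²) E_ρ[F²]
  -- each.
  set α := κ * N / δ ^ 2 with hα
  have hα0 : 0 < α := by positivity
  have hpt : ∀ s, |∑ b, ((π' i s).1 b - (π i s).1 b) * (G.Qbar σ i s b - G.Qbar π i s b)|
      ≤ (A * (N / (2 * δ) + G.γ * α / (2 * δ))) * sqDist (π' i) (π i) s +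
        (1 / (2 * N * δ) * F s ^ 2 + G.γ / (2 * α * δ ^ 2) * M s) := by
    intro s
    set c := l1Dist (π' i) (π i) s with hc
    have hc0 : 0 ≤ c := l1Dist_nonneg _ _ _
    have h1 : ∀ b, |G.Qbar σ i s b - G.Qbar π i s b|
        ≤ 1 / δ * F s + G.γ / δ * √(M s / δ) := fun b => by
      refine (abs_Qbar_sub_le σ π i hF hd s b).trans (add_le_add_right ?_ _)
      refine mul_le_mul_of_nonneg_left (Real.le_sqrt_of_sq_le ?_) (by positivity)
      rw [le_div_iff₀ hδ, mul_comm]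
      exact (sq_marginal_resolvent_le σ i hF s b).trans (hMle s b)
    refine (abs_sum_mul_le h1).trans ?_
    -- The weight N offsets the factor N lost in F² ≤ N A ∑ sqDist.
    have h2 := mul_le_weighted (α := (N : ℝ)) (by positivity) c (F s)
    have h3 := mul_le_weighted hα0 c √(M s / δ)
    rw [Real.sq_sqrt (div_nonneg (hM0 s) hδ.le)] at h3
    have h4 : c ^ 2 ≤ A * sqDist (π' i) (π i) s := sq_l1Dist_le _ _ _
    calc c * (1 / δ * F s + G.γ / δ * √(M s / δ))
        = 1 / δ * (c * F s) + G.γ / δ * (c * √(M s / δ)) := by ring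
      _ ≤ 1 / δ * (N / 2 * c ^ 2 + 1 / (2 * N) * F s ^ 2) +
          G.γ / δ * (α / 2 * c ^ 2 + 1 / (2 * α) * (M s / δ)) := by gcongr
      _ = (N / (2 * δ) + G.γ * α / (2 * δ)) * c ^ 2 +
          (1 / (2 * N * δ) * F s ^ 2 + G.γ / (2 * α * δ ^ 2) * M s) := by
        field_simp
        ring
      _ ≤ (N / (2 * δ) + G.γ * α / (2 * δ)) * (A * sqDist (π' i) (π i) s) +
          (1 / (2 * N * δ) * F s ^ 2 + G.γ / (2 * α * δ ^ 2) * M s) := by gcongr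
      _ = _ := by ring
  have hbs := bdd_sqDist (π' i) (π i)
  have hb : Bdd fun s =>
      |∑ b, ((π' i s).1 b - (π i s).1 b) * (G.Qbar σ i s b - G.Qbar π i s b)| :=
    (Bdd.sum _ fun b _ => ((bdd_policy _ b).sub (bdd_policy _ b)).mul
      ((bdd_Qbar _ _ b).sub (bdd_Qbar _ _ b))).abs
  have hocc := occ_mono (G := G) (π := τ) hb ((hbs.const_mul _).add
    ((hF.sq.const_mul _).add (hM.const_mul _))) hpt
  rw [occ_add (hbs.const_mul _) ((hF.sq.const_mul _).add (hM.const_mul _)),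
    occ_add (hF.sq.const_mul _) (hM.const_mul _), occ_const_mul _ hbs, occ_const_mul _ hF.sq,
    occ_const_mul _ hM] at hocc
  have hX0 : 0 ≤ G.occ τ (sqDist (π' i) (π i)) :=
    expect_nonneg _ (resolvent_nonneg hbs fun s => sqDist_nonneg _ _ _)
  have hFF : expect G.ρ (fun s => F s ^ 2) ≤ N * A * expect G.ρ n := by
    rw [← expect_const_mul]
    exact expect_mono _ hF.sq (hn.const_mul _) (sq_sum_l1Dist_le π π')
  have hoF : G.occ τ (fun s => F s ^ 2) ≤ κ / δ * expect G.ρ (fun s => F s ^ 2) :=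
    occ_le hk hF.sq fun s => sq_nonneg _
  have hoM : G.occ τ M ≤ κ / δ * expect G.ρ M := occ_le hk hM hM0
  refine hocc.trans (add_le_add (mul_le_mul_of_nonneg_right ?_ hX0) ?_)
  · have e1 : (N : ℝ) / (2 * δ) ≤ κ * N / (2 * δ ^ 3) := by
      rw [div_le_div_iff₀ (by positivity) (by positivity)]
      have : δ ^ 3 ≤ δ := by nlinarith [pow_le_one₀ hδ.le hδ1 (n := 2)]
      nlinarith [mul_le_mul hκ this (by positivity) (by positivity)]
    have e2 : G.γ * α / (2 * δ) ≤ κ * N / (2 * δ ^ 3) := by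
      have : α / (2 * δ) = κ * N / (2 * δ ^ 3) := by rw [hα]; field_simp
      rw [mul_div_assoc, this]
      exact mul_le_of_le_one_left (by positivity) hγ1
    calc (A : ℝ) * (N / (2 * δ) + G.γ * α / (2 * δ))
        ≤ A * (κ * N / (2 * δ ^ 3) + κ * N / (2 * δ ^ 3)) := by gcongr
      _ = _ := by field_simp; ring
  · calc 1 / (2 * N * δ) * G.occ τ (fun s => F s ^ 2) + G.γ / (2 * α * δ ^ 2) * G.occ τ M
        ≤ 1 / (2 * N * δ) * (κ / δ * expect G.ρ (fun s => F s ^ 2)) +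
          G.γ / (2 * α * δ ^ 2) * (κ / δ * expect G.ρ M) := by gcongr
      _ = 1 / (2 * N * δ) * (κ / δ * expect G.ρ (fun s => F s ^ 2)) +
          κ / (2 * α * δ ^ 4) * (G.γ * (δ * expect G.ρ M)) := by field_simp
      _ ≤ 1 / (2 * N * δ) * (κ / δ * expect G.ρ (fun s => F s ^ 2)) +
          κ / (2 * α * δ ^ 4) * (κ * expect G.ρ (fun s => F s ^ 2)) := by gcongr
      _ = κ / (N * δ ^ 2) * expect G.ρ (fun s => F s ^ 2) := by
        rw [hα]
        field_simp
        ring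
      _ ≤ κ / (N * δ ^ 2) * (N * A * expect G.ρ n) := by gcongr
      _ = _ := by field_simp

/-! ### Improvement of the potential -/

/-- Squared error of the estimated averaged action values `q`. -/
def sqErr (G : Game N A S) (π : Policy N A S) (q : Fin N → S → Fin A → ℝ) (i : Fin N) (s : S) : ℝ :=
  ∑ b, (G.Qbar π i s b - q i s b) ^ 2

theorem sqErr_nonneg (q : Fin N → S → Fin A → ℝ) (i : Fin N) (s : S) : 0 ≤ G.sqErr π q i s :=
  Finset.sum_nonneg fun _ _ => sq_nonneg _

theorem bdd_sqErr {q : Fin N → S → Fin A → ℝ} {i : Fin N} (hq : ∀ b, Bdd fun s => q i s b) :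
    Bdd (G.sqErr π q i) :=
  Bdd.sum _ fun b _ => ((bdd_Qbar _ _ b).sub (hq b)).sq

/-- In units of sqDist/η, the proximal step earns 1, the estimation error takes 1/4 and the
interaction 1/16, leaving 11/16. The last term on the right is the share of the interaction caused
by all players; its factor 1/N survives summation over i. -/
theorem occ_V_mix_sub (hA : 1 ≤ A) (hk : G.kappa ≠ ⊤) {π π' : Policy N A S}
    {q : Fin N → S → Fin A → ℝ} (i : Fin N) (hq : ∀ b, Bdd fun s => q i s b) {η : ℝ} (hη : 0 < η)
    (hprox : ∀ s, sqDist (π' i) (π i) s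
      ≤ η * ∑ b, ((π' i s).1 b - (π i s).1 b) * q i s b)
    (hstep : 16 * G.kappa.toReal * N * A * η ≤ (1 - G.γ) ^ 3) :
    11 / (16 * η) * expect G.ρ (sqDist (π' i) (π i))
      ≤ expect G.ρ (fun s => G.V (mix π π' (i.val + 1)) i s - G.V (mix π π' i.val) i s) +
        η * G.kappa.toReal / (1 - G.γ) * expect G.ρ (G.sqErr π q i) +
        1 / (16 * η * N) * expect G.ρ (fun s => ∑ j, sqDist (π' j) (π j) s) := by
  have hint := occ_interaction_le hA hk π π' i
  have hV : expect G.ρ (fun s => G.V (mix π π' (i.val + 1)) i s - G.V (mix π π' i.val) i s)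
      = G.occ (mix π π' (i.val + 1)) fun s =>
        ∑ b, ((π' i s).1 b - (π i s).1 b) * G.Qbar (mix π π' i.val) i s b := by
    rw [occ, mix_succ]
    congr 1
    funext s
    rw [V_update_sub, mix_at]
  rw [hV]
  set σ := mix π π' i.val
  set τ := mix π π' (i.val + 1)
  set κ := G.kappa.toReal with hκdef
  have hκ : 1 ≤ κ := one_le_kappa hk π
  have hN : (1 : ℝ) ≤ N := by exact_mod_cast i.pos
  set δ := 1 - G.γ with hδdef
  have hδ : 0 < δ := one_sub_pos
  have hδ1 : δ ≤ 1 := one_sub_le_one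
  set H : S → ℝ := fun s => |∑ b, ((π' i s).1 b - (π i s).1 b) *
    (G.Qbar σ i s b - G.Qbar π i s b)| with hH
  have hHb : Bdd H := (Bdd.sum _ fun b _ => ((bdd_policy _ b).sub (bdd_policy _ b)).mul
      ((bdd_Qbar _ _ b).sub (bdd_Qbar _ _ b))).abs
  have hbs := bdd_sqDist (π' i) (π i)
  have hbe : Bdd (G.sqErr π q i) := bdd_sqErr hq
  have hbg : Bdd fun s => ∑ b, ((π' i s).1 b - (π i s).1 b) * G.Qbar σ i s b :=
    Bdd.sum _ fun b _ => ((bdd_policy _ b).sub (bdd_policy _ b)).mul (bdd_Qbar _ _ b)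
  have hpt : ∀ s, 3 / (4 * η) * sqDist (π' i) (π i) s
      ≤ (∑ b, ((π' i s).1 b - (π i s).1 b) * G.Qbar σ i s b) +
        (η * G.sqErr π q i s + H s) := by
    intro s
    have h1 : sqDist (π' i) (π i) s / η ≤ ∑ b, ((π' i s).1 b - (π i s).1 b) * q i s b := by
      rw [div_le_iff₀' hη]
      exact hprox s
    have h2 : -(∑ b, ((π' i s).1 b - (π i s).1 b) * (G.Qbar π i s b - q i s b))
        ≤ 1 / (4 * η) * sqDist (π' i) (π i) s + η * G.sqErr π q i s := by
      rw [sqDist, sqErr, Finset.mul_sum, Finset.mul_sum, ← Finset.sum_add_distrib,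
        ← Finset.sum_neg_distrib]
      refine Finset.sum_le_sum fun b _ => ?_
      have := mul_le_weighted (α := 1 / (2 * η)) (by positivity)
        (-((π' i s).1 b - (π i s).1 b)) (G.Qbar π i s b - q i s b)
      rw [neg_sq] at this
      have e1 : 1 / (2 * η) / 2 = 1 / (4 * η) := by field_simp; ring
      have e2 : 1 / (2 * (1 / (2 * η))) = η := by field_simp
      rw [e1, e2] at this
      linarith
    have h3 := neg_abs_le (∑ b, ((π' i s).1 b - (π i s).1 b) *
      (G.Qbar σ i s b - G.Qbar π i s b))
    have h4 : ∑ b, ((π' i s).1 b - (π i s).1 b) * G.Qbar σ i s b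
        = (∑ b, ((π' i s).1 b - (π i s).1 b) * q i s b) +
          (∑ b, ((π' i s).1 b - (π i s).1 b) * (G.Qbar π i s b - q i s b)) +
          ∑ b, ((π' i s).1 b - (π i s).1 b) * (G.Qbar σ i s b - G.Qbar π i s b) := by
      rw [← Finset.sum_add_distrib, ← Finset.sum_add_distrib]
      exact Finset.sum_congr rfl fun b _ => by ring
    have e3 : 3 / (4 * η) * sqDist (π' i) (π i) s
        = sqDist (π' i) (π i) s / η - 1 / (4 * η) * sqDist (π' i) (π i) s := by
      field_simp
      ring
    simp only [hH]
    linarith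
  have hocc := occ_mono (G := G) (π := τ) (hbs.const_mul _)
    (hbg.add ((hbe.const_mul _).add hHb)) hpt
  rw [occ_add hbg ((hbe.const_mul _).add hHb), occ_add (hbe.const_mul _) hHb,
    occ_const_mul _ hbs, occ_const_mul _ hbe] at hocc
  have hoe : G.occ τ (G.sqErr π q i) ≤ κ / δ * expect G.ρ (G.sqErr π q i) :=
    occ_le hk hbe (sqErr_nonneg q i)
  have hoe' := mul_le_mul_of_nonneg_left hoe hη.le
  have hX : expect G.ρ (sqDist (π' i) (π i)) ≤ G.occ τ (sqDist (π' i) (π i)) :=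
    expect_le_occ hbs fun s => sqDist_nonneg _ _ _
  have hD0 : 0 ≤ expect G.ρ (sqDist (π' i) (π i)) := expect_nonneg _ fun s => sqDist_nonneg _ _ _
  have hn0 : 0 ≤ expect G.ρ (fun s => ∑ j, sqDist (π' j) (π j) s) :=
    expect_nonneg _ fun s => Finset.sum_nonneg fun j _ => sqDist_nonneg _ _ _
  have hc1 : κ * N * A / δ ^ 3 ≤ 1 / (16 * η) := by
    rw [div_le_div_iff₀ (by positivity) (by positivity)]
    linarith
  have hc2 : κ * A / δ ^ 2 ≤ 1 / (16 * η * N) := by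
    rw [div_le_div_iff₀ (by positivity) (by positivity)]
    have : δ ^ 3 ≤ δ ^ 2 := pow_le_pow_of_le_one hδ.le hδ1 (by norm_num)
    linarith
  have h5 := mul_le_mul_of_nonneg_right hc1 (hD0.trans hX)
  have h6 := mul_le_mul_of_nonneg_right hc2 hn0
  have h7 : 11 / (16 * η) * expect G.ρ (sqDist (π' i) (π i))
      ≤ 11 / (16 * η) * G.occ τ (sqDist (π' i) (π i)) := by gcongr
  have h8 : 3 / (4 * η) * G.occ τ (sqDist (π' i) (π i)) -
      1 / (16 * η) * G.occ τ (sqDist (π' i) (π i))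
        = 11 / (16 * η) * G.occ τ (sqDist (π' i) (π i)) := by
    field_simp
    ring
  have h9 : η * (κ / δ * expect G.ρ (G.sqErr π q i))
      = η * κ / δ * expect G.ρ (G.sqErr π q i) := by ring
  linarith

/-- Improvement of the potential by simultaneous proximal steps of all players. -/
theorem potential_improvement (hN : 1 ≤ N) (hA : 1 ≤ A) (hk : G.kappa ≠ ⊤)
    {Φ : Policy N A S → S → ℝ} (hΦ : G.IsPotential Φ) {π π' : Policy N A S}
    {q : Fin N → S → Fin A → ℝ} (hq : ∀ i b, Bdd fun s => q i s b) {η : ℝ} (hη : 0 < η)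
    (hprox : ∀ i s, sqDist (π' i) (π i) s
      ≤ η * ∑ b, ((π' i s).1 b - (π i s).1 b) * q i s b)
    (hstep : 16 * G.kappa.toReal * N * A * η ≤ (1 - G.γ) ^ 3) :
    1 / (2 * η) * ∑ i, expect G.ρ (sqDist (π' i) (π i))
      ≤ expect G.ρ (fun s => Φ π' s - Φ π s) +
        η * G.kappa.toReal / (1 - G.γ) * ∑ i, expect G.ρ (G.sqErr π q i) := by
  have hN' : (0 : ℝ) < N := by exact_mod_cast hN
  -- Between consecutive hybrids only player i moves, so the potential increment is exactly the
  -- increment of V_i.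
  have hpot : expect G.ρ (fun s => Φ π' s - Φ π s) = ∑ i : Fin N,
      expect G.ρ (fun s => G.V (mix π π' (i.val + 1)) i s - G.V (mix π π' i.val) i s) := by
    rw [← expect_sum _ _ fun i _ => (bdd_V i).sub (bdd_V i)]
    congr 1
    funext s
    have h := sum_telescope (N := N) fun k => Φ (mix π π' k) s
    simp only [mix_last, mix_zero] at h
    rw [← h]
    refine Finset.sum_congr rfl fun i _ => ?_
    have h2 := hΦ i (mix π π' i.val) (π' i) (mix π π' i.val i) s
    rw [Function.update_eq_self, ← mix_succ] at h2
    exact h2.symm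
  have hsum := Finset.sum_le_sum fun (i : Fin N) (_ : i ∈ Finset.univ) =>
    occ_V_mix_sub hA hk i (hq i) hη (hprox i) hstep
  rw [Finset.sum_add_distrib, Finset.sum_add_distrib, ← hpot, ← Finset.mul_sum, ← Finset.mul_sum,
    Finset.sum_const, Finset.card_univ, Fintype.card_fin, nsmul_eq_mul,
    expect_sum _ _ fun j _ => bdd_sqDist _ _] at hsum
  set D := ∑ i, expect G.ρ (sqDist (π' i) (π i))
  have hD0 : 0 ≤ D := Finset.sum_nonneg fun i _ => expect_nonneg _ fun s => sqDist_nonneg _ _ _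
  have h1 : (N : ℝ) * (1 / (16 * η * N) * D) = 1 / (16 * η) * D := by field_simp
  rw [h1] at hsum
  -- The surplus 1/(8η) is discarded.
  have h2 : 11 / (16 * η) * D - 1 / (16 * η) * D = 1 / (2 * η) * D + 1 / (8 * η) * D := by
    field_simp
    ring
  have h3 : 0 ≤ 1 / (8 * η) * D := by positivity
  linarith

end Game

/-! ### The simplex and the proximal step -/

theorem sum_sq_sub_le_two {x y : Fin A → ℝ} (hx : x ∈ stdSimplex ℝ (Fin A))
    (hy : y ∈ stdSimplex ℝ (Fin A)) : ∑ b, (x b - y b) ^ 2 ≤ 2 := by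
  have h1 : ∀ {z : Fin A → ℝ}, z ∈ stdSimplex ℝ (Fin A) → ∀ b, z b ^ 2 ≤ z b := by
    intro z hz b
    have hb : z b ≤ 1 := by
      rw [← hz.2]
      exact Finset.single_le_sum (fun c _ => hz.1 c) (Finset.mem_univ b)
    nlinarith [hz.1 b]
  calc ∑ b, (x b - y b) ^ 2 ≤ ∑ b, (x b + y b) := Finset.sum_le_sum fun b _ => by
        nlinarith [h1 hx b, h1 hy b, mul_nonneg (hx.1 b) (hy.1 b)]
    _ = 2 := by rw [Finset.sum_add_distrib, hx.2, hy.2]; norm_num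

theorem abs_sum_sub_mul_le {x y c : Fin A → ℝ} (hx : x ∈ stdSimplex ℝ (Fin A))
    (hy : y ∈ stdSimplex ℝ (Fin A)) {W : ℝ} (hc : ∀ b, |c b| ≤ W) :
    |∑ b, (x b - y b) * c b| ≤ 2 * W := by
  have h1 : ∀ {z : Fin A → ℝ}, z ∈ stdSimplex ℝ (Fin A) → |∑ b, z b * c b| ≤ W := by
    intro z hz
    refine (abs_sum_mul_le hc).trans ?_
    rw [Finset.sum_congr rfl fun b _ => abs_of_nonneg (hz.1 b), hz.2, one_mul]
  simp only [sub_mul, Finset.sum_sub_distrib]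
  exact (abs_sub _ _).trans (by linarith [h1 hx, h1 hy])

theorem uniform_mem (hA : 1 ≤ A) : (fun _ => 1 / (A : ℝ)) ∈ stdSimplex ℝ (Fin A) := by
  refine ⟨fun _ => by positivity, ?_⟩
  have : (A : ℝ) ≠ 0 := by positivity
  simp [this]

theorem segment_mem_greedySimplex {ξ t : ℝ} (h0 : 0 ≤ t) (h1 : t ≤ 1) {p x : Fin A → ℝ}
    (hp : p ∈ greedySimplex A ξ) (hx : x ∈ greedySimplex A ξ) :
    (fun b => p b + t * (x b - p b)) ∈ greedySimplex A ξ := by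
  obtain ⟨u, hu, rfl⟩ := hp
  obtain ⟨v, hv, rfl⟩ := hx
  refine ⟨fun b => (1 - t) * u b + t * v b, ⟨fun b => ?_, ?_⟩, ?_⟩
  · exact add_nonneg (mul_nonneg (by linarith) (hu.1 b)) (mul_nonneg h0 (hv.1 b))
  · rw [Finset.sum_add_distrib, ← Finset.mul_sum, ← Finset.mul_sum, hu.2, hv.2]
    ring
  · funext b
    ring

/-- First-order optimality condition of the proximal step. -/
theorem prox_variational {η ξ : ℝ} (hη : 0 < η) {q p₀ p x : Fin A → ℝ}
    (hp : p ∈ greedySimplex A ξ) (hmax : IsMaxOn (proxObj η q p₀) (greedySimplex A ξ) p)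
    (hx : x ∈ greedySimplex A ξ) :
    ∑ b, (x b - p b) * (p₀ b + η * q b - p b) ≤ 0 := by
  set a := ∑ b, (x b - p b) * (p₀ b + η * q b - p b) with ha
  set c := ∑ b, (x b - p b) ^ 2 with hc
  have hc0 : 0 ≤ c := Finset.sum_nonneg fun _ _ => sq_nonneg _
  -- Maximality of p against p + t(x - p): a/η is the directional derivative of the objective, and c
  -- measures its curvature.
  have key : ∀ t : ℝ, 0 < t → t ≤ 1 → a ≤ t / 2 * c := by
    intro t h0 h1
    have h := hmax (segment_mem_greedySimplex h0.le h1 hp hx)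
    simp only [Set.mem_ofPred_eq, proxObj] at h
    have e : η * ((∑ b, (p b + t * (x b - p b)) * q b -
        1 / (2 * η) * ∑ b, (p b + t * (x b - p b) - p₀ b) ^ 2) -
        (∑ b, p b * q b - 1 / (2 * η) * ∑ b, (p b - p₀ b) ^ 2)) = t * (a - t / 2 * c) := by
      have e1 : ∀ z : ℝ, η * (1 / (2 * η) * z) = z / 2 := fun z => by field_simp
      rw [mul_sub, mul_sub, mul_sub, e1, e1, ha, hc, Finset.mul_sum, Finset.mul_sum,
        Finset.sum_div, Finset.sum_div, ← Finset.sum_sub_distrib, ← Finset.sum_sub_distrib,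
        ← Finset.sum_sub_distrib, Finset.mul_sum, ← Finset.sum_sub_distrib, Finset.mul_sum]
      exact Finset.sum_congr rfl fun b _ => by ring
    have h2 : t * (a - t / 2 * c) ≤ 0 := by
      rw [← e]
      exact mul_nonpos_of_nonneg_of_nonpos hη.le (by linarith)
    nlinarith
  by_contra hneg
  push Not at hneg
  -- If a > 0, this t lies in (0, 1] and gives t c / 2 < a, also when c = 0.
  have h := key (a / (a + c)) (by positivity) ((div_le_one (by positivity)).2 (by linarith))
  have h3 : a / (a + c) / 2 * c < a := by
    rw [div_div, div_mul_eq_mul_div, div_lt_iff₀ (by positivity)]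
    nlinarith
  linarith

/-- The proximal step is the Euclidean projection of p₀ + ηq, hence nonexpansive: add the two
variational inequalities, each tested at the other solution. -/
theorem sum_sq_prox_sub_le {η ξ : ℝ} (hη : 0 < η) {q p₀ p q' p₀' p' : Fin A → ℝ}
    (hp : p ∈ greedySimplex A ξ) (hmax : IsMaxOn (proxObj η q p₀) (greedySimplex A ξ) p)
    (hp' : p' ∈ greedySimplex A ξ) (hmax' : IsMaxOn (proxObj η q' p₀') (greedySimplex A ξ) p') :
    ∑ b, (p b - p' b) ^ 2 ≤ ∑ b, ((p₀ b + η * q b) - (p₀' b + η * q' b)) ^ 2 := by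
  have h1 := prox_variational hη hp hmax hp'
  have h2 := prox_variational hη hp' hmax' hp
  have h3 : ∑ b, (p b - p' b) ^ 2 - ∑ b, ((p₀ b + η * q b) - (p₀' b + η * q' b)) ^ 2
      ≤ 2 * ∑ b, (p' b - p b) * (p₀ b + η * q b - p b) +
        2 * ∑ b, (p b - p' b) * (p₀' b + η * q' b - p' b) := by
    rw [Finset.mul_sum, Finset.mul_sum, ← Finset.sum_sub_distrib, ← Finset.sum_add_distrib]
    refine Finset.sum_le_sum fun b _ => ?_
    nlinarith [sq_nonneg ((p b - p' b) - ((p₀ b + η * q b) - (p₀' b + η * q' b)))]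
  linarith

/-- Each coordinate of p is a 1-Lipschitz function of y on the range of y. Extending it to the whole
space gives a continuous function composed with a measurable one, so the measurability of that range
is irrelevant. -/
theorem measurable_of_sum_sq_le {Ω : Type*} [MeasurableSpace Ω] {y p : Ω → Fin A → ℝ}
    (hy : ∀ b, Measurable fun ω => y ω b)
    (h : ∀ ω ω', ∑ b, (p ω b - p ω' b) ^ 2 ≤ ∑ b, (y ω b - y ω' b) ^ 2) (b : Fin A) :
    Measurable fun ω => p ω b := by
  classical
  set Y : Ω → EuclideanSpace ℝ (Fin A) := fun ω => WithLp.toLp 2 (y ω) with hY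
  have hYm : Measurable Y :=
    (PiLp.continuous_toLp 2 fun _ : Fin A => ℝ).measurable.comp (measurable_pi_lambda _ hy)
  have hd : ∀ ω ω', |p ω b - p ω' b| ≤ dist (Y ω) (Y ω') := by
    intro ω ω'
    rw [EuclideanSpace.dist_eq]
    refine Real.abs_le_sqrt ?_
    refine (Finset.single_le_sum (f := fun b => (p ω b - p ω' b) ^ 2)
      (fun _ _ => sq_nonneg _) (Finset.mem_univ b)).trans ((h ω ω').trans (le_of_eq ?_))
    exact Finset.sum_congr rfl fun c _ => by rw [Real.dist_eq, sq_abs]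
  set f : EuclideanSpace ℝ (Fin A) → ℝ := fun z => if hz : ∃ ω, Y ω = z then p hz.choose b else 0
  have hf : ∀ ω, f (Y ω) = p ω b := by
    intro ω
    have hz : ∃ ω', Y ω' = Y ω := ⟨ω, rfl⟩
    have h1 := hd hz.choose ω
    rw [hz.choose_spec, dist_self] at h1
    simp only [f, dif_pos hz]
    exact sub_eq_zero.1 (abs_nonpos_iff.1 h1)
  have hL : LipschitzOnWith 1 f (Set.range Y) := by
    refine LipschitzOnWith.of_dist_le_mul ?_
    rintro _ ⟨ω, rfl⟩ _ ⟨ω', rfl⟩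
    rw [hf, hf, Real.dist_eq, NNReal.coe_one, one_mul]
    exact hd ω ω'
  obtain ⟨g, hg, hfg⟩ := hL.extend_real
  have : (fun ω => p ω b) = fun ω => g (Y ω) := by
    funext ω
    rw [← hf, hfg ⟨ω, rfl⟩]
  rw [this]
  exact hg.continuous.measurable.comp hYm

/-! ### Measurability in a random policy -/

namespace Game
variable {G : Game N A S}

section Measurability
variable {Ω : Type*} [MeasurableSpace Ω] {X : Ω → Policy N A S}

theorem measurable_expect_jointAct (hX : ∀ i s b, Measurable fun ω => (X ω i s).1 b) (s : S)
    {g : Ω → (Fin N → Fin A) → ℝ} (hg : ∀ a, Measurable fun ω => g ω a) :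
    Measurable fun ω => expect (jointAct (X ω) s) (g ω) := by
  simp only [expect_jointAct]
  exact Finset.measurable_fun_sum _ fun a _ =>
    (Finset.measurable_fun_prod _ fun i _ => hX i s (a i)).mul (hg a)

theorem measurable_iterate_trans (hX : ∀ i s b, Measurable fun ω => (X ω i s).1 b)
    {f : Ω → S → ℝ} (hb : ∀ ω, Bdd (f ω)) (hf : ∀ s, Measurable fun ω => f ω s) (t : ℕ) :
    ∀ s, Measurable fun ω => (G.trans (X ω))^[t] (f ω) s := by
  induction t with
  | zero => exact hf
  | succ t ih =>
    intro s
    have hbt : ∀ ω, Bdd ((G.trans (X ω))^[t] (f ω)) := fun ω => by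
      obtain ⟨B, hB⟩ := hb ω
      exact ⟨B, abs_iterate_trans_le hB t⟩
    simp only [Function.iterate_succ_apply', trans_eq _ (hbt _)]
    exact measurable_expect_jointAct hX s fun a => measurable_expect _ ih

theorem measurable_resolvent (hX : ∀ i s b, Measurable fun ω => (X ω i s).1 b)
    {f : Ω → S → ℝ} (hb : ∀ ω, Bdd (f ω)) (hf : ∀ s, Measurable fun ω => f ω s) (s : S) :
    Measurable fun ω => G.resolvent (X ω) (f ω) s :=
  Measurable.tsum fun t => (measurable_iterate_trans hX hb hf t s).const_mul _

theorem measurable_Q (hX : ∀ i s b, Measurable fun ω => (X ω i s).1 b) (i : Fin N) (s : S)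
    (a : Fin N → Fin A) : Measurable fun ω => G.Q (X ω) i s a := by
  simp only [Q_eq, V_eq_resolvent]
  refine ((measurable_expect _ fun s' => ?_).const_mul _).const_add _
  exact measurable_resolvent hX (fun ω => bdd_meanReward i)
    (fun s => measurable_expect_jointAct hX s fun a => measurable_const) s'

theorem measurable_Qbar (hX : ∀ i s b, Measurable fun ω => (X ω i s).1 b) (i : Fin N) (s : S)
    (b : Fin A) : Measurable fun ω => G.Qbar (X ω) i s b :=
  Finset.measurable_fun_sum _ fun a _ =>
    (Finset.measurable_fun_prod _ fun j _ => hX j s (a j)).mul (measurable_Q hX i s a)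

end Measurability

/-! ### Regression loss -/

theorem abs_inner_le {φ : Fin N → S → Fin A → EuclideanSpace ℝ (Fin d)} {W : ℝ}
    (hφ : ∀ i s b, ‖φ i s b‖ ≤ 1) {w : EuclideanSpace ℝ (Fin d)} (hw : ‖w‖ ≤ W)
    (i : Fin N) (s : S) (b : Fin A) : |(inner ℝ (φ i s b) w : ℝ)| ≤ W := by
  refine (abs_real_inner_le_norm _ _).trans ?_
  calc ‖φ i s b‖ * ‖w‖ ≤ 1 * ‖w‖ := mul_le_mul_of_nonneg_right (hφ i s b) (norm_nonneg _)
    _ ≤ W := by rwa [one_mul]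

theorem regLoss_eq_occ {φ : Fin N → S → Fin A → EuclideanSpace ℝ (Fin d)}
    (hφ : ∀ i s b, ‖φ i s b‖ ≤ 1) (π : Policy N A S) (i : Fin N)
    (w : EuclideanSpace ℝ (Fin d)) :
    (Bdd fun s => ∑ b, (π i s).1 b * (G.Qbar π i s b - inner ℝ (φ i s b) w) ^ 2) ∧
    G.regLoss φ π i w = (1 - G.γ) * G.occ π
      fun s => ∑ b, (π i s).1 b * (G.Qbar π i s b - inner ℝ (φ i s b) w) ^ 2 := by
  have hb : Bdd fun s => ∑ b, (π i s).1 b * (G.Qbar π i s b - inner ℝ (φ i s b) w) ^ 2 :=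
    Bdd.sum _ fun b _ => (bdd_policy _ b).mul
      ((bdd_Qbar _ _ b).sub ⟨‖w‖, fun s => abs_inner_le hφ le_rfl i s b⟩).sq
  exact ⟨hb, visit_tsum_toReal hb fun s =>
    Finset.sum_nonneg fun b _ => mul_nonneg ((π i s).2.1 b) (sq_nonneg _)⟩

theorem measurable_regLoss {Ω : Type*} [MeasurableSpace Ω] {X : Ω → Policy N A S}
    (hX : ∀ i s b, Measurable fun ω => (X ω i s).1 b)
    {φ : Fin N → S → Fin A → EuclideanSpace ℝ (Fin d)} (hφ : ∀ i s b, ‖φ i s b‖ ≤ 1)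
    (i : Fin N) {w : Ω → EuclideanSpace ℝ (Fin d)} (hw : Measurable w) :
    Measurable fun ω => G.regLoss φ (X ω) i (w ω) := by
  simp only [(regLoss_eq_occ hφ _ i _).2, occ]
  refine (measurable_expect _ fun s => ?_).const_mul _
  refine measurable_resolvent hX (fun ω => (regLoss_eq_occ hφ _ i _).1) (fun s => ?_) s
  exact Finset.measurable_fun_sum _ fun b _ => (hX i s b).mul
    (((measurable_Qbar hX i s b).sub (measurable_const.inner hw)).pow_const 2)

/-- Exploration turns the on-policy regression loss into a bound on the uniform squared error. -/
theorem expect_sqErr_le {φ : Fin N → S → Fin A → EuclideanSpace ℝ (Fin d)}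
    (hφ : ∀ i s b, ‖φ i s b‖ ≤ 1) {π : Policy N A S} {i : Fin N} {c : ℝ} (hc : 0 < c)
    (hπ : ∀ s b, c ≤ (π i s).1 b) (w : Fin N → EuclideanSpace ℝ (Fin d)) :
    expect G.ρ (G.sqErr π (fun i s b => inner ℝ (φ i s b) (w i)) i)
      ≤ 1 / (c * (1 - G.γ)) * G.regLoss φ π i (w i) := by
  obtain ⟨hb, he⟩ := regLoss_eq_occ (G := G) hφ π i (w i)
  have hδ := one_sub_pos (G := G)
  have h1 := expect_le_occ (π := π) (G := G) hb fun s =>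
    Finset.sum_nonneg fun b _ => mul_nonneg ((π i s).2.1 b) (sq_nonneg _)
  have h2 := expect_mono G.ρ ((bdd_sqErr (G := G) (π := π) (i := i)
    (q := fun i s b => inner ℝ (φ i s b) (w i))
    fun b => ⟨‖w i‖, fun s => abs_inner_le hφ le_rfl i s b⟩).const_mul c) hb fun s => by
      rw [sqErr, Finset.mul_sum]
      exact Finset.sum_le_sum fun b _ => mul_le_mul_of_nonneg_right (hπ s b) (sq_nonneg _)
  rw [expect_const_mul] at h2
  have h3 := mul_le_mul_of_nonneg_left (h2.trans h1) hδ.le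
  rw [← he] at h3
  rw [one_div, ← div_eq_inv_mul, le_div_iff₀ (by positivity)]
  linarith

/-! ### Bounds on the gap of a player -/

theorem Vρ_update_sub (π : Policy N A S) (i : Fin N) (p : PlayerPolicy A S) :
    G.Vρ (Function.update π i p) i - G.Vρ π i = G.occ (Function.update π i p)
      (fun s => ∑ b, ((p s).1 b - (π i s).1 b) * G.Qbar π i s b) := by
  rw [Vρ, Vρ, ← expect_sub _ (bdd_V i) (bdd_V i)]
  exact congrArg _ (funext (V_update_sub π i p))

theorem bdd_advantage (π : Policy N A S) (i : Fin N) (p : PlayerPolicy A S) :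
    Bdd fun s => ∑ b, ((p s).1 b - (π i s).1 b) * G.Qbar π i s b :=
  Bdd.sum _ fun b _ => ((bdd_policy _ b).sub (bdd_policy _ b)).mul (bdd_Qbar _ _ b)

theorem gap_le {π : Policy N A S} {i : Fin N} {c : ℝ}
    (h : ∀ p : PlayerPolicy A S, G.Vρ (Function.update π i p) i - G.Vρ π i ≤ c) :
    G.gap π i ≤ c := by
  have : Nonempty (PlayerPolicy A S) := ⟨π i⟩
  have h1 : (⨆ p : PlayerPolicy A S, G.Vρ (Function.update π i p) i) ≤ c + G.Vρ π i :=
    ciSup_le fun p => by linarith [h p]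
  rw [gap]
  linarith

theorem gap_le_trivial {π : Policy N A S} {i : Fin N} {W : ℝ}
    (hQ : ∀ s b, |G.Qbar π i s b| ≤ W) : G.gap π i ≤ 2 * W / (1 - G.γ) := by
  refine gap_le fun p => ?_
  rw [Vρ_update_sub, ← occ_const (G := G) (π := Function.update π i p)]
  exact occ_mono (bdd_advantage π i p) (Bdd.const _) fun s =>
    (le_abs_self _).trans (abs_sum_sub_mul_le (p s).2 (π i s).2 (hQ s))

/-- Bound of the gap of a player by the size of her update and the estimation error. -/
theorem gap_le_update (hA : 1 ≤ A) (hk : G.kappa ≠ ⊤) {π π' : Policy N A S} {i : Fin N} {W ξ η : ℝ}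
    (hξ : 0 ≤ ξ) (hη : 0 < η) (hηA : η ^ 2 * A ≤ (1 - G.γ) ^ 2)
    (hQ : ∀ s b, |G.Qbar π i s b| ≤ W) {q : Fin N → S → Fin A → ℝ}
    (hq : ∀ b, Bdd fun s => q i s b)
    (hvar : ∀ s, ∀ x ∈ greedySimplex A ξ,
      ∑ b, (x b - (π' i s).1 b) * ((π i s).1 b + η * q i s b - (π' i s).1 b) ≤ 0)
    (hξ1 : ξ ≤ 1) {v v' : ℝ} (hv : 0 < v) (hv' : 0 < v') :
    G.gap π i ≤ 2 * ξ * W / (1 - G.γ) +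
      1 / η * (3 / 2 * v / (1 - G.γ) +
        G.kappa.toReal / ((1 - G.γ) * v) * expect G.ρ (sqDist (π' i) (π i))) +
      (v' / (1 - G.γ) +
        G.kappa.toReal / (2 * (1 - G.γ) * v') * expect G.ρ (G.sqErr π q i)) := by
  refine gap_le fun p => ?_
  rw [Vρ_update_sub]
  set τ := Function.update π i p
  have hδ := one_sub_pos (G := G)
  set δ := 1 - G.γ
  have hbs := bdd_sqDist (π' i) (π i)
  have hbe : Bdd (G.sqErr π q i) := bdd_sqErr hq
  have hpt : ∀ s, ∑ b, ((p s).1 b - (π i s).1 b) * G.Qbar π i s b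
      ≤ (2 * ξ * W + 1 / η * (3 / 2 * v) + v') +
        (1 / (η * v) * sqDist (π' i) (π i) s + 1 / (2 * v') * G.sqErr π q i s) := by
    intro s
    -- The deviation p need not be admissible in `hvar`; its ξ-greedy version x is, and exchanging
    -- them costs 2ξW.
    set x : Fin A → ℝ := fun b => (1 - ξ) * (p s).1 b + ξ * (1 / (A : ℝ)) with hx
    have hxm : x ∈ greedySimplex A ξ := ⟨(p s).1, (p s).2, rfl⟩
    have hxs : x ∈ stdSimplex ℝ (Fin A) := by
      have := convex_stdSimplex ℝ (Fin A) (p s).2 (uniform_mem hA) (sub_nonneg.2 hξ1) hξ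
        (by ring)
      exact this
    have hvx := hvar s x hxm
    set y := (π' i s).1 with hy
    have hys : y ∈ stdSimplex ℝ (Fin A) := (π' i s).2
    have h2 := sum_sq_sub_le_two hxs hys
    -- The five terms are the exploration bias, the optimality condition (nonpositive), the
    -- displacement, the estimation error, and the gain from the update itself.
    have hsplit : ∑ b, ((p s).1 b - (π i s).1 b) * G.Qbar π i s b
        = ξ * ∑ b, ((p s).1 b - 1 / (A : ℝ)) * G.Qbar π i s b +
          1 / η * ∑ b, (x b - y b) * ((π i s).1 b + η * q i s b - y b) +
          1 / η * ∑ b, (x b - y b) * (y b - (π i s).1 b) +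
          ∑ b, (x b - y b) * (G.Qbar π i s b - q i s b) +
          ∑ b, (y b - (π i s).1 b) * G.Qbar π i s b := by
      simp only [Finset.mul_sum, ← Finset.sum_add_distrib]
      refine Finset.sum_congr rfl fun b _ => ?_
      simp only [hx]
      field_simp
      ring
    have t1 : ξ * ∑ b, ((p s).1 b - 1 / (A : ℝ)) * G.Qbar π i s b ≤ 2 * ξ * W := by
      have := mul_le_mul_of_nonneg_left ((le_abs_self _).trans
        (abs_sum_sub_mul_le (p s).2 (uniform_mem hA) (hQ s))) hξ
      linarith
    have t2 : 1 / η * ∑ b, (x b - y b) * ((π i s).1 b + η * q i s b - y b) ≤ 0 :=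
      mul_nonpos_of_nonneg_of_nonpos (by positivity) hvx
    have t3 : ∑ b, (x b - y b) * (y b - (π i s).1 b)
        ≤ v + 1 / (2 * v) * sqDist (π' i) (π i) s := by
      calc _ ≤ ∑ b, (v / 2 * (x b - y b) ^ 2 + 1 / (2 * v) * (y b - (π i s).1 b) ^ 2) :=
            Finset.sum_le_sum fun b _ => mul_le_weighted hv _ _
        _ = v / 2 * (∑ b, (x b - y b) ^ 2) + 1 / (2 * v) * sqDist (π' i) (π i) s := by
            rw [Finset.sum_add_distrib, ← Finset.mul_sum, ← Finset.mul_sum, sqDist]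
        _ ≤ _ := by
            have := mul_le_mul_of_nonneg_left h2 (half_pos hv).le
            linarith
    have t3' := mul_le_mul_of_nonneg_left t3 (one_div_pos.2 hη).le
    have t4 : ∑ b, (x b - y b) * (G.Qbar π i s b - q i s b)
        ≤ v' + 1 / (2 * v') * G.sqErr π q i s := by
      calc _ ≤ ∑ b, (v' / 2 * (x b - y b) ^ 2 +
              1 / (2 * v') * (G.Qbar π i s b - q i s b) ^ 2) :=
            Finset.sum_le_sum fun b _ => mul_le_weighted hv' _ _
        _ = v' / 2 * (∑ b, (x b - y b) ^ 2) + 1 / (2 * v') * G.sqErr π q i s := by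
            rw [Finset.sum_add_distrib, ← Finset.mul_sum, ← Finset.mul_sum, sqErr]
        _ ≤ _ := by
            have := mul_le_mul_of_nonneg_left h2 (half_pos hv').le
            linarith
    -- Since η² ∑ Qbar² ≤ η² A/δ² ≤ 1, this term takes the same form as the displacement term.
    have t5 : ∑ b, (y b - (π i s).1 b) * G.Qbar π i s b
        ≤ 1 / η * (v / 2 + 1 / (2 * v) * sqDist (π' i) (π i) s) := by
      have hQ2 : ∑ b, G.Qbar π i s b ^ 2 ≤ A / δ ^ 2 := by
        calc ∑ b, G.Qbar π i s b ^ 2 ≤ ∑ _b : Fin A, (1 / δ) ^ 2 :=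
              Finset.sum_le_sum fun b _ => by
                rw [← sq_abs]
                exact pow_le_pow_left₀ (abs_nonneg _) (abs_Qbar_le π i s b) 2
          _ = A / δ ^ 2 := by simp [div_eq_mul_inv]
      calc _ ≤ ∑ b, (1 / (η * v) / 2 * (y b - (π i s).1 b) ^ 2 +
              1 / (2 * (1 / (η * v))) * G.Qbar π i s b ^ 2) :=
            Finset.sum_le_sum fun b _ => mul_le_weighted (by positivity) _ _
        _ = 1 / (η * v) / 2 * sqDist (π' i) (π i) s +
              η * v / 2 * ∑ b, G.Qbar π i s b ^ 2 := by
            rw [Finset.sum_add_distrib, ← Finset.mul_sum, ← Finset.mul_sum, sqDist]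
            congr 2
            field_simp
        _ ≤ 1 / (η * v) / 2 * sqDist (π' i) (π i) s + η * v / 2 * (1 / η ^ 2) := by
            refine add_le_add_right (mul_le_mul_of_nonneg_left (hQ2.trans ?_) (by positivity)) _
            rw [div_le_div_iff₀ (by positivity) (by positivity)]
            linarith
        _ = _ := by field_simp; ring
    have e1 : 1 / η * (v + 1 / (2 * v) * sqDist (π' i) (π i) s) +
        1 / η * (v / 2 + 1 / (2 * v) * sqDist (π' i) (π i) s)
          = 1 / η * (3 / 2 * v) + 1 / (η * v) * sqDist (π' i) (π i) s := by
      field_simp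
      ring
    rw [hsplit]
    linarith
  have hocc := occ_mono (G := G) (π := τ) (bdd_advantage π i p) ((Bdd.const _).add
    ((hbs.const_mul _).add (hbe.const_mul _))) hpt
  rw [occ_add (Bdd.const _) ((hbs.const_mul _).add (hbe.const_mul _)),
    occ_add (hbs.const_mul _) (hbe.const_mul _), occ_const_mul _ hbs, occ_const_mul _ hbe,
    occ_const] at hocc
  have hs := occ_le (π := τ) hk hbs fun s => sqDist_nonneg (π' i) (π i) s
  have he := occ_le (π := τ) hk hbe fun s => sqErr_nonneg q i s
  refine hocc.trans ?_
  calc _ ≤ (2 * ξ * W + 1 / η * (3 / 2 * v) + v') / δ +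
        (1 / (η * v) * (G.kappa.toReal / δ * expect G.ρ (sqDist (π' i) (π i))) +
          1 / (2 * v') * (G.kappa.toReal / δ * expect G.ρ (G.sqErr π q i))) := by gcongr
    _ = _ := by
      field_simp
      ring

end Game

/-! ### Regret along a run -/

theorem le_of_mem_greedySimplex {ξ : ℝ} (hξ1 : ξ ≤ 1) {p : Fin A → ℝ} (hp : p ∈ greedySimplex A ξ)
    (b : Fin A) : ξ / A ≤ p b := by
  obtain ⟨q, hq, rfl⟩ := hp
  have := mul_nonneg (sub_nonneg.2 hξ1) (hq.1 b)
  rw [div_eq_mul_one_div]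
  linarith

namespace Game
variable {G : Game N A S}

theorem regLoss_nonneg (φ : Fin N → S → Fin A → EuclideanSpace ℝ (Fin d)) (π : Policy N A S)
    (i : Fin N) (w : EuclideanSpace ℝ (Fin d)) : 0 ≤ G.regLoss φ π i w :=
  tsum_nonneg fun s => mul_nonneg ENNReal.toReal_nonneg
    (Finset.sum_nonneg fun b _ => mul_nonneg ((π i s).2.1 b) (sq_nonneg _))

theorem LinearQ.abs_Qbar_le {φ : Fin N → S → Fin A → EuclideanSpace ℝ (Fin d)} {W : ℝ}
    (h : G.LinearQ φ W) (π : Policy N A S) (i : Fin N) (s : S) (b : Fin A) :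
    |G.Qbar π i s b| ≤ W := by
  obtain ⟨w, hw, hQ⟩ := h.2 i π
  rw [hQ]
  exact abs_inner_le h.1 hw i s b

theorem nashRegret_le_trivial {φ : Fin N → S → Fin A → EuclideanSpace ℝ (Fin d)} {W : ℝ}
    (hN : 1 ≤ N) {T : ℕ} (hT : 1 ≤ T) (h : G.LinearQ φ W) (π : ℕ → Policy N A S) :
    G.nashRegret T π ≤ 2 * W / (1 - G.γ) := by
  have : Nonempty (Fin N) := ⟨⟨0, hN⟩⟩
  have hT' : (0 : ℝ) < T := by exact_mod_cast hT
  rw [nashRegret, one_div, ← div_eq_inv_mul, div_le_iff₀ hT']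
  calc _ ≤ ∑ _t ∈ Finset.Icc 1 T, 2 * W / (1 - G.γ) := Finset.sum_le_sum fun t _ =>
        ciSup_le fun i => gap_le_trivial (h.abs_Qbar_le (π t) i)
    _ = _ := by rw [Finset.sum_const, Nat.card_Icc, nsmul_eq_mul, Nat.add_sub_cancel, mul_comm]

end Game

namespace Run
variable {G : Game N A S} {φ : Fin N → S → Fin A → EuclideanSpace ℝ (Fin d)} {W η ξ : ℝ}
  {K T : ℕ} {Ω : Type*} [mΩ : MeasurableSpace Ω] {μ : Measure Ω}

theorem policy_mem_greedySimplex (R : Run G φ W η ξ K T μ) (hA : 1 ≤ A) {t : ℕ} (h1 : 1 ≤ t)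
    (hT : t ≤ T + 1) (ω : Ω) (i : Fin N) (s : S) : (R.policy t ω i s).1 ∈ greedySimplex A ξ := by
  obtain ⟨u, rfl⟩ := Nat.exists_eq_add_of_le' h1
  rcases Nat.eq_zero_or_pos u with rfl | hu
  · refine ⟨_, uniform_mem hA, ?_⟩
    funext b
    rw [R.policy_one]
    ring
  · exact R.policy_mem u (Finset.mem_Icc.2 ⟨hu, by omega⟩) ω i s

theorem measurable_policy (R : Run G φ W η ξ K T μ) (hη : 0 < η) {t : ℕ} (h1 : 1 ≤ t)
    (hT : t ≤ T + 1) (i : Fin N) (s : S) :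
    ∀ b, Measurable fun ω => (R.policy t ω i s).1 b := by
  induction t, h1 using Nat.le_induction with
  | base =>
    intro b
    simp only [R.policy_one]
    exact measurable_const
  | succ t h1 ih =>
    have ht : t ∈ Finset.Icc 1 T := Finset.mem_Icc.2 ⟨h1, by omega⟩
    have hw : Measurable (R.what t i) := (R.what_meas t ht i).mono (R.ℱ.le _) le_rfl
    refine measurable_of_sum_sq_le
      (y := fun ω b => (R.policy t ω i s).1 b + η * inner ℝ (φ i s b) (R.what t i ω))
      (p := fun ω => (R.policy (t + 1) ω i s).1) (fun b => ?_) fun ω ω' => ?_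
    · exact (ih (by omega) b).add ((measurable_const.inner hw).const_mul η)
    · exact sum_sq_prox_sub_le hη (R.policy_mem t ht ω i s) (R.policy_max t ht ω i s)
        (R.policy_mem t ht ω' i s) (R.policy_max t ht ω' i s)

/-- The estimated averaged action values of iteration `t`. -/
def qhat (R : Run G φ W η ξ K T μ) (t : ℕ) (ω : Ω) (i : Fin N) (s : S) (b : Fin A) : ℝ :=
  inner ℝ (φ i s b) (R.what t i ω)

theorem bdd_qhat (R : Run G φ W η ξ K T μ) (hφ : ∀ i s b, ‖φ i s b‖ ≤ 1) (t : ℕ) (ω : Ω)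
    (i : Fin N) (b : Fin A) : Bdd fun s => R.qhat t ω i s b :=
  ⟨‖R.what t i ω‖, fun s => Game.abs_inner_le hφ le_rfl i s b⟩

theorem policy_variational (R : Run G φ W η ξ K T μ) (hη : 0 < η) {t : ℕ}
    (ht : t ∈ Finset.Icc 1 T) (ω : Ω) (i : Fin N) (s : S) {x : Fin A → ℝ}
    (hx : x ∈ greedySimplex A ξ) :
    ∑ b, (x b - (R.policy (t + 1) ω i s).1 b) *
      ((R.policy t ω i s).1 b + η * R.qhat t ω i s b - (R.policy (t + 1) ω i s).1 b) ≤ 0 :=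
  prox_variational hη (R.policy_mem t ht ω i s) (R.policy_max t ht ω i s) hx

/-- The optimality condition tested at the current policy, which is admissible: later iterates lie
in the greedy simplex by construction, and the uniform initial policy lies in it too. -/
theorem sqDist_policy_le (R : Run G φ W η ξ K T μ) (hA : 1 ≤ A) (hη : 0 < η) {t : ℕ}
    (ht : t ∈ Finset.Icc 1 T) (ω : Ω) (i : Fin N) (s : S) :
    sqDist (R.policy (t + 1) ω i) (R.policy t ω i) s ≤
      η * ∑ b, ((R.policy (t + 1) ω i s).1 b - (R.policy t ω i s).1 b) * R.qhat t ω i s b := by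
  have ht' := Finset.mem_Icc.1 ht
  have h := R.policy_variational hη ht ω i s
    (R.policy_mem_greedySimplex hA ht'.1 (by omega) ω i s)
  rw [sqDist, Finset.mul_sum, ← sub_nonpos, ← Finset.sum_sub_distrib]
  refine le_trans (le_of_eq (Finset.sum_congr rfl fun b _ => ?_)) h
  ring

/-- Bound of the Nash regret along a run by the total regression loss. -/
theorem nashRegret_le (R : Run G φ W η ξ K T μ) (hN : 1 ≤ N) (hA : 1 ≤ A) (hT : 1 ≤ T)
    {Φ : Policy N A S → S → ℝ} (hΦ : G.IsPotential Φ) {Φmax : ℝ}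
    (hΦmax : ∀ (π π' : Policy N A S) s, |Φ π s - Φ π' s| ≤ Φmax)
    (hk : G.kappa ≠ ⊤) (hlin : G.LinearQ φ W) (hξ : 0 < ξ) (hξ1 : ξ ≤ 1) (hη : 0 < η)
    (hstep : 16 * G.kappa.toReal * N * A * η ≤ (1 - G.γ) ^ 3) {v v' : ℝ} (hv : 0 < v)
    (hv' : 0 < v') (ω : Ω) :
    G.nashRegret T (fun t => R.policy t ω) ≤
      (2 * ξ * W / (1 - G.γ) + 3 / 2 * v / (η * (1 - G.γ)) + v' / (1 - G.γ) +
        2 * G.kappa.toReal * Φmax / ((1 - G.γ) * v * T)) +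
      (2 * η * G.kappa.toReal ^ 2 / (v * (1 - G.γ) ^ 2) +
        G.kappa.toReal / (2 * (1 - G.γ) * v')) * (A / (ξ * (1 - G.γ)) / T) *
        ∑ t ∈ Finset.Icc 1 T, ∑ i, G.regLoss φ (R.policy t ω) i (R.what t i ω) := by
  have : Nonempty (Fin N) := ⟨⟨0, hN⟩⟩
  have hT' : (0 : ℝ) < T := by exact_mod_cast hT
  have hA' : (1 : ℝ) ≤ A := by exact_mod_cast hA
  have hN' : (1 : ℝ) ≤ N := by exact_mod_cast hN
  have hδ := Game.one_sub_pos (G := G)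
  have hδ1 := Game.one_sub_le_one (G := G)
  set δ := 1 - G.γ with hδdef
  set κ := G.kappa.toReal with hκdef
  have hκ : 1 ≤ κ := Game.one_le_kappa hk (R.policy 1 ω)
  have hηA : η ^ 2 * A ≤ δ ^ 2 := by
    have h1 : A * η ≤ δ := by
      have h2 : δ ^ 3 ≤ δ := by nlinarith [pow_le_one₀ hδ.le hδ1 (n := 2)]
      have h3 : 1 * (A * η) ≤ 16 * κ * N * (A * η) := by
        gcongr
        nlinarith
      linarith
    have h4 : (A * η) ^ 2 ≤ δ ^ 2 := pow_le_pow_left₀ (by positivity) h1 2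
    have h5 : η ^ 2 * A ≤ η ^ 2 * A ^ 2 := by
      gcongr
      nlinarith
    linarith
  set D : ℕ → ℝ := fun t =>
    ∑ i, expect G.ρ (sqDist (R.policy (t + 1) ω i) (R.policy t ω i)) with hD
  set e : ℕ → ℝ := fun t => ∑ i, expect G.ρ (G.sqErr (R.policy t ω) (R.qhat t ω) i) with he
  -- The potential is taken relative to the first policy, since only differences of Φ are known to
  -- be bounded.
  set P : ℕ → ℝ := fun t =>
    expect G.ρ fun s => Φ (R.policy t ω) s - Φ (R.policy 1 ω) s with hP
  have hbΦ : ∀ π π' : Policy N A S, Bdd fun s => Φ π s - Φ π' s := fun π π' =>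
    ⟨Φmax, hΦmax π π'⟩
  have himp : ∀ t ∈ Finset.Icc 1 T, D t ≤ 2 * η * (P (t + 1) - P t + η * κ / δ * e t) := by
    intro t ht
    have h := Game.potential_improvement hN hA hk hΦ
      (q := R.qhat t ω) (R.bdd_qhat hlin.1 t ω) hη
      (fun i s => R.sqDist_policy_le hA hη ht ω i s) hstep
    have h2 : expect G.ρ (fun s => Φ (R.policy (t + 1) ω) s - Φ (R.policy t ω) s)
        = P (t + 1) - P t := by
      rw [hP, ← expect_sub _ (hbΦ _ _) (hbΦ _ _)]
      congr 1
      funext s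
      ring
    rw [h2] at h
    have h3 := mul_le_mul_of_nonneg_left h (by positivity : 0 ≤ 2 * η)
    rwa [← mul_assoc, mul_one_div_cancel (by positivity), one_mul] at h3
  have hgap : ∀ t ∈ Finset.Icc 1 T, (⨆ i, G.gap (R.policy t ω) i) ≤
      (2 * ξ * W / δ + 3 / 2 * v / (η * δ) + v' / δ) +
        (2 * κ / (δ * v) * (P (t + 1) - P t) +
          (2 * η * κ ^ 2 / (v * δ ^ 2) + κ / (2 * δ * v')) * e t) := by
    intro t ht
    refine ciSup_le fun i => ?_
    have h := Game.gap_le_update (π := R.policy t ω) (π' := R.policy (t + 1) ω) (i := i) hA hk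
      hξ.le hη hηA (hlin.abs_Qbar_le _ i) (R.bdd_qhat hlin.1 t ω i)
      (fun s x hx => R.policy_variational hη ht ω i s hx) hξ1 hv hv'
    have hDi : expect G.ρ (sqDist (R.policy (t + 1) ω i) (R.policy t ω i)) ≤ D t :=
      Finset.single_le_sum
        (f := fun i => expect G.ρ (sqDist (R.policy (t + 1) ω i) (R.policy t ω i)))
        (fun j _ => expect_nonneg _ fun s => sqDist_nonneg _ _ _) (Finset.mem_univ i)
    have hei : expect G.ρ (G.sqErr (R.policy t ω) (R.qhat t ω) i) ≤ e t :=
      Finset.single_le_sum (f := fun i => expect G.ρ (G.sqErr (R.policy t ω) (R.qhat t ω) i))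
        (fun j _ => expect_nonneg _ fun s => Game.sqErr_nonneg _ _ _) (Finset.mem_univ i)
    refine h.trans ?_
    calc _ ≤ 2 * ξ * W / δ + 1 / η * (3 / 2 * v / δ +
          κ / (δ * v) * (2 * η * (P (t + 1) - P t + η * κ / δ * e t))) +
          (v' / δ + κ / (2 * δ * v') * e t) := by
          gcongr
          exact hDi.trans (himp t ht)
      _ = _ := by
          field_simp
          ring
  have hPT : P (T + 1) - P 1 ≤ Φmax := by
    have h1 : P 1 = 0 := by simp [hP, expect]
    rw [h1, sub_zero]
    exact (le_abs_self _).trans (abs_expect_le _ fun s => hΦmax _ _ s)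
  have htel : ∑ t ∈ Finset.Icc 1 T, (P (t + 1) - P t) = P (T + 1) - P 1 := by
    rw [← Finset.Ico_add_one_right_eq_Icc, Finset.sum_Ico_sub P (by omega)]
  have hel : ∀ t ∈ Finset.Icc 1 T, e t ≤ A / (ξ * δ) *
      ∑ i, G.regLoss φ (R.policy t ω) i (R.what t i ω) := by
    intro t ht
    have ht' := Finset.mem_Icc.1 ht
    rw [Finset.mul_sum]
    refine Finset.sum_le_sum fun i _ => ?_
    have h := Game.expect_sqErr_le (G := G) hlin.1 (π := R.policy t ω) (i := i)
      (c := ξ / A) (by positivity) (fun s b => le_of_mem_greedySimplex hξ1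
        (R.policy_mem_greedySimplex hA ht'.1 (by omega) ω i s) b) fun j => R.what t j ω
    refine h.trans (le_of_eq ?_)
    rw [← hδdef]
    congr 1
    field_simp
  have hcoef : 0 ≤ 2 * η * κ ^ 2 / (v * δ ^ 2) + κ / (2 * δ * v') := by positivity
  rw [Game.nashRegret, one_div, ← div_eq_inv_mul, div_le_iff₀ hT']
  calc _ ≤ ∑ t ∈ Finset.Icc 1 T, ((2 * ξ * W / δ + 3 / 2 * v / (η * δ) + v' / δ) +
        (2 * κ / (δ * v) * (P (t + 1) - P t) +
          (2 * η * κ ^ 2 / (v * δ ^ 2) + κ / (2 * δ * v')) * (A / (ξ * δ) *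
            ∑ i, G.regLoss φ (R.policy t ω) i (R.what t i ω)))) :=
        Finset.sum_le_sum fun t ht => (hgap t ht).trans (by gcongr; exact hel t ht)
    _ = T * (2 * ξ * W / δ + 3 / 2 * v / (η * δ) + v' / δ) +
        (2 * κ / (δ * v) * (P (T + 1) - P 1) +
          (2 * η * κ ^ 2 / (v * δ ^ 2) + κ / (2 * δ * v')) * (A / (ξ * δ) *
            ∑ t ∈ Finset.Icc 1 T, ∑ i, G.regLoss φ (R.policy t ω) i (R.what t i ω))) := by
        rw [Finset.sum_add_distrib, Finset.sum_const, Nat.card_Icc, nsmul_eq_mul,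
          Nat.add_sub_cancel, Finset.sum_add_distrib, ← Finset.mul_sum, htel, ← Finset.mul_sum,
          ← Finset.mul_sum]
    _ ≤ T * (2 * ξ * W / δ + 3 / 2 * v / (η * δ) + v' / δ) +
        (2 * κ / (δ * v) * Φmax +
          (2 * η * κ ^ 2 / (v * δ ^ 2) + κ / (2 * δ * v')) * (A / (ξ * δ) *
            ∑ t ∈ Finset.Icc 1 T, ∑ i, G.regLoss φ (R.policy t ω) i (R.what t i ω))) := by
        gcongr
    _ = _ := by
        generalize (∑ t ∈ Finset.Icc 1 T, ∑ i, G.regLoss φ (R.policy t ω) i (R.what t i ω)) = Λ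
        field_simp
        ring

/-- The pathwise bound is integrated. Only the regression losses, on the larger side, need to be
measurable; the regret is compared by monotonicity of the integral. -/
theorem lintegral_nashRegret_le [IsProbabilityMeasure μ] (R : Run G φ W η ξ K T μ)
    (hN : 1 ≤ N) (hA : 1 ≤ A) (hT : 1 ≤ T)
    {Φ : Policy N A S → S → ℝ} (hΦ : G.IsPotential Φ) {Φmax ε : ℝ} (hΦ0 : 0 < Φmax)
    (hΦmax : ∀ (π π' : Policy N A S) s, |Φ π s - Φ π' s| ≤ Φmax)
    (hk : G.kappa ≠ ⊤) (hlin : G.LinearQ φ W) (hW : 0 < W) (hξ : 0 < ξ) (hξ1 : ξ ≤ 1) (hη : 0 < η)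
    (hε : 0 < ε)
    (hstep : 16 * G.kappa.toReal * N * A * η ≤ (1 - G.γ) ^ 3)
    (hstat : ∀ t ∈ Finset.Icc 1 T, ∀ i,
      ∫⁻ ω, ENNReal.ofReal (G.regLoss φ (R.policy t ω) i (R.what t i ω)) ∂μ ≤ ENNReal.ofReal ε)
    (hξε : ξ ^ 3 = G.kappa.toReal ^ 2 * N * A * ε / ((1 - G.γ) ^ 2 * W ^ 2)) :
    ∫⁻ ω, ENNReal.ofReal (G.nashRegret T fun t => R.policy t ω) ∂μ ≤
      ENNReal.ofReal (4 * (√(G.kappa.toReal * Φmax / (T * η)) / (1 - G.γ)) +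
        7 * (ξ * W / (1 - G.γ))) := by
  have hT' : (0 : ℝ) < T := by exact_mod_cast hT
  have hA' : (0 : ℝ) < A := by exact_mod_cast hA
  have hN' : (0 : ℝ) < N := by exact_mod_cast hN
  have hδ := Game.one_sub_pos (G := G)
  have hδ1 := Game.one_sub_le_one (G := G)
  obtain ⟨ω₀⟩ : Nonempty Ω := μ.nonempty_of_neZero
  have hκ : 1 ≤ G.kappa.toReal := Game.one_le_kappa hk (R.policy 1 ω₀)
  have hpt := fun v v' hv hv' ω => R.nashRegret_le hN hA hT hΦ hΦmax hk hlin hξ hξ1 hη hstep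
    (v := v) (v' := v') hv hv' ω
  set δ := 1 - G.γ with hδdef
  set κ := G.kappa.toReal with hκdef
  set B := √(κ * Φmax / (T * η)) with hB
  have hB0 : 0 < B := Real.sqrt_pos.2 (by positivity)
  have hB2 : B ^ 2 = κ * Φmax / (T * η) := Real.sq_sqrt (by positivity)
  have hεeq : ε = ξ ^ 3 * (δ ^ 2 * W ^ 2) / (κ ^ 2 * N * A) := by
    rw [hξε]
    field_simp
  -- The part ηB balances v/η against κΦmax/(vT), since B² = κΦmax/(Tη). The part ηξW, like the
  -- value ξW for the other weight, balances the statistical error, because ε is proportional to ξ³.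
  set v := η * B + η * (ξ * W) with hvdef
  have hv : 0 < v := by positivity
  have hv' : 0 < ξ * W := by positivity
  specialize hpt v (ξ * W) hv hv'
  set a := 2 * ξ * W / δ + 3 / 2 * v / (η * δ) + ξ * W / δ + 2 * κ * Φmax / (δ * v * T) with ha
  set c := (2 * η * κ ^ 2 / (v * δ ^ 2) + κ / (2 * δ * (ξ * W))) * (A / (ξ * δ) / T) with hc
  have ha0 : 0 ≤ a := by positivity
  have hc0 : 0 ≤ c := by positivity
  have hmeas : ∀ t ∈ Finset.Icc 1 T, ∀ i, Measurable fun ω =>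
      ENNReal.ofReal (G.regLoss φ (R.policy t ω) i (R.what t i ω)) := by
    intro t ht i
    have ht' := Finset.mem_Icc.1 ht
    exact (Game.measurable_regLoss (fun j s b => R.measurable_policy hη ht'.1 (by omega) j s b)
      hlin.1 i ((R.what_meas t ht i).mono (R.ℱ.le _) le_rfl)).ennreal_ofReal
  have hL0 : ∀ ω t i, 0 ≤ G.regLoss φ (R.policy t ω) i (R.what t i ω) := fun ω t i =>
    Game.regLoss_nonneg _ _ _ _
  have hfinal : a + c * (T * (N * ε)) ≤ 4 * (B / δ) + 7 * (ξ * W / δ) := by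
    have h1 : 3 / 2 * v / (η * δ) = 3 / 2 * (B / δ) + 3 / 2 * (ξ * W / δ) := by
      rw [hvdef]
      field_simp
    have h2 : 2 * κ * Φmax / (δ * v * T) ≤ 2 * (B / δ) := by
      have : 2 * (B / δ) = 2 * κ * Φmax / (δ * (η * B) * T) := by
        have e : κ * Φmax = B ^ 2 * (T * η) := by
          rw [hB2]
          field_simp
        rw [mul_assoc 2 κ, e]
        field_simp
      rw [this]
      gcongr
      exact le_add_of_nonneg_right (by positivity)
    have h3 : c * (T * (N * ε)) = 2 * η * (ξ * W) ^ 2 / (v * δ) +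
        1 / (2 * κ) * (ξ * W) := by
      rw [hc, hεeq]
      field_simp
    have h4 : 2 * η * (ξ * W) ^ 2 / (v * δ) ≤ 2 * (ξ * W / δ) := by
      have : 2 * (ξ * W / δ) = 2 * η * (ξ * W) ^ 2 / (η * (ξ * W) * δ) := by
        field_simp
      rw [this]
      gcongr
      exact le_add_of_nonneg_left (by positivity)
    have h5 : 1 / (2 * κ) * (ξ * W) ≤ 1 / 2 * (ξ * W / δ) := by
      have e1 : 1 / (2 * κ) ≤ 1 / 2 := one_div_le_one_div_of_le (by norm_num) (by linarith)
      have e2 : ξ * W ≤ ξ * W / δ := le_div_self hv'.le hδ hδ1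
      gcongr
    have h6 : 2 * ξ * W / δ = 2 * (ξ * W / δ) := by ring
    have h7 : 0 ≤ B / δ := by positivity
    rw [ha, h1, h3, h6]
    linarith
  calc ∫⁻ ω, ENNReal.ofReal (G.nashRegret T fun t => R.policy t ω) ∂μ
      ≤ ∫⁻ ω, (ENNReal.ofReal a + ENNReal.ofReal c * ∑ t ∈ Finset.Icc 1 T, ∑ i,
          ENNReal.ofReal (G.regLoss φ (R.policy t ω) i (R.what t i ω))) ∂μ := by
        refine lintegral_mono fun ω => ?_
        refine (ENNReal.ofReal_le_ofReal (hpt ω)).trans ?_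
        rw [ENNReal.ofReal_add ha0 (mul_nonneg hc0 (Finset.sum_nonneg fun t _ =>
          Finset.sum_nonneg fun i _ => hL0 ω t i)), ENNReal.ofReal_mul hc0,
          ENNReal.ofReal_sum_of_nonneg fun t _ => Finset.sum_nonneg fun i _ => hL0 ω t i]
        simp only [ENNReal.ofReal_sum_of_nonneg fun i _ => hL0 ω _ i, le_refl]
    _ = ENNReal.ofReal a + ENNReal.ofReal c * ∑ t ∈ Finset.Icc 1 T, ∑ i,
          ∫⁻ ω, ENNReal.ofReal (G.regLoss φ (R.policy t ω) i (R.what t i ω)) ∂μ := by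
        rw [lintegral_add_left measurable_const, lintegral_const, measure_univ, mul_one,
          lintegral_const_mul' _ _ ENNReal.ofReal_ne_top, lintegral_finsetSum' _ fun t ht =>
            (Finset.measurable_fun_sum _ fun i _ => hmeas t ht i).aemeasurable]
        congr 2
        exact Finset.sum_congr rfl fun t ht => lintegral_finsetSum' _ fun i _ =>
          (hmeas t ht i).aemeasurable
    _ ≤ ENNReal.ofReal a + ENNReal.ofReal c * ∑ t ∈ Finset.Icc 1 T, ∑ _i : Fin N,
          ENNReal.ofReal ε := by
        gcongr with t ht i _
        exact hstat t ht i
    _ = ENNReal.ofReal (a + c * (T * (N * ε))) := by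
        rw [ENNReal.ofReal_add ha0 (by positivity), ENNReal.ofReal_mul hc0,
          ENNReal.ofReal_mul hT'.le, ENNReal.ofReal_mul hN'.le]
        simp
    _ ≤ _ := ENNReal.ofReal_le_ofReal hfinal

end Run

/-! ### Arithmetic of the rates -/

theorem rpow_one_third_cube {x : ℝ} (hx : 0 ≤ x) : (x ^ (1 / 3 : ℝ)) ^ 3 = x := by
  rw [← Real.rpow_natCast, ← Real.rpow_mul hx]
  norm_num

theorem Run.lintegral_nashRegret_le_of_radius {G : Game N A S}
    {φ : Fin N → S → Fin A → EuclideanSpace ℝ (Fin d)} {W η ξ : ℝ}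
    {K T : ℕ} {Ω : Type*} [MeasurableSpace Ω] {μ : Measure Ω} [IsProbabilityMeasure μ]
    (R : Run G φ W η ξ K T μ) (hN : 1 ≤ N) (hT : 1 ≤ T) (hlin : G.LinearQ φ W) {c : ℝ}
    (hc : 2 * W / (1 - G.γ) ≤ c) :
    ∫⁻ ω, ENNReal.ofReal (G.nashRegret T fun t => R.policy t ω) ∂μ ≤ ENNReal.ofReal c := by
  calc _ ≤ ∫⁻ _ω, ENNReal.ofReal c ∂μ := lintegral_mono fun ω =>
        ENNReal.ofReal_le_ofReal ((Game.nashRegret_le_trivial hN hT hlin _).trans hc)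
    _ = _ := by rw [lintegral_const, measure_univ, mul_one]

/-- The statistical part of the bound in terms of the untruncated exploration rate. -/
theorem stat_term_eq {κ n a ε δ W : ℝ} (hκ : 0 < κ) (hn : 0 < n) (ha : 0 < a) (hε : 0 < ε)
    (hδ : 0 < δ) (hW : 0 < W) :
    (κ ^ 2 * W * a * n * ε / δ ^ 5) ^ (1 / 3 : ℝ)
      = (κ ^ 2 * n * a * ε / (δ ^ 2 * W ^ 2)) ^ (1 / 3 : ℝ) * W / δ := by
  refine (pow_left_inj₀ (by positivity) (by positivity) (n := 3) (by norm_num)).1 ?_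
  rw [rpow_one_third_cube (by positivity), div_pow, mul_pow, rpow_one_third_cube (by positivity)]
  field_simp

theorem rpow_quarter_pow {x : ℝ} (hx : 0 ≤ x) : (x ^ (1 / 4 : ℝ)) ^ 4 = x := by
  rw [← Real.rpow_natCast, ← Real.rpow_mul hx]
  norm_num

theorem rate_pow_four {κ W n a F δ T : ℝ} (hκ : 0 < κ) (hW : 0 < W) (hn : 0 < n) (ha : 0 < a)
    (hF : 0 < F) (hδ : 0 < δ) (hT : 0 < T) :
    (√(κ * W * n) * (a * F) ^ (1 / 4 : ℝ) / (δ ^ (7 / 4 : ℝ) * T ^ (1 / 4 : ℝ))) ^ 4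
      = (κ * W * n) ^ 2 * (a * F) / (δ ^ 7 * T) := by
  have h1 : √(κ * W * n) ^ 4 = (κ * W * n) ^ 2 := by
    rw [show 4 = 2 * 2 from rfl, pow_mul, Real.sq_sqrt (by positivity)]
  have h2 : (δ ^ (7 / 4 : ℝ)) ^ 4 = δ ^ 7 := by
    rw [← Real.rpow_natCast, ← Real.rpow_mul hδ.le, ← Real.rpow_natCast]
    norm_num
  rw [div_pow, mul_pow, mul_pow, h1, h2, rpow_quarter_pow (by positivity),
    rpow_quarter_pow hT.le]

theorem sq_stepsize {W n a F δ T : ℝ} (ha : 0 < a)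
    (hF : 0 < F) (hδ : 0 < δ) (hT : 0 < T) :
    (δ ^ (3 / 2 : ℝ) * √F / (W * n * √(a * T))) ^ 2 = δ ^ 3 * F / ((W * n) ^ 2 * (a * T)) := by
  have h2 : (δ ^ (3 / 2 : ℝ)) ^ 2 = δ ^ 3 := by
    rw [← Real.rpow_natCast, ← Real.rpow_mul hδ.le, ← Real.rpow_natCast]
    norm_num
  rw [div_pow, mul_pow, mul_pow, h2, Real.sq_sqrt hF.le, Real.sq_sqrt (by positivity)]

theorem main_term_eq_rate {κ W n a F δ T : ℝ} (hκ : 0 < κ) (hW : 0 < W) (hn : 0 < n) (ha : 0 < a)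
    (hF : 0 < F) (hδ : 0 < δ) (hT : 0 < T) :
    √(κ * F / (T * (δ ^ (3 / 2 : ℝ) * √F / (W * n * √(a * T))))) / δ
      = √(κ * W * n) * (a * F) ^ (1 / 4 : ℝ) / (δ ^ (7 / 4 : ℝ) * T ^ (1 / 4 : ℝ)) := by
  refine (pow_left_inj₀ (by positivity) (by positivity) (n := 4) (by norm_num)).1 ?_
  rw [rate_pow_four hκ hW hn ha hF hδ hT, div_pow, show 4 = 2 * 2 from rfl, pow_mul,
    Real.sq_sqrt (by positivity), div_pow, mul_pow T, sq_stepsize ha hF hδ hT]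
  field_simp

/-- A stepsize violating the smallness condition means that T is small, δ³W²T ≤ 256κ²aF; then the
rate itself dominates the trivial bound. The factor 4 is the fourth root of 256 = 16². -/
theorem radius_le_rate {κ W n a F δ T : ℝ} (hκ : 0 < κ) (hW : 0 < W) (hn : 1 ≤ n) (ha : 0 < a)
    (hF : 0 < F) (hδ : 0 < δ) (hT : 0 < T)
    (h : δ ^ 3 < 16 * κ * n * a * (δ ^ (3 / 2 : ℝ) * √F / (W * n * √(a * T)))) :
    W / δ ≤
      4 * (√(κ * W * n) * (a * F) ^ (1 / 4 : ℝ) / (δ ^ (7 / 4 : ℝ) * T ^ (1 / 4 : ℝ))) := by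
  have hn0 : 0 < n := by linarith
  refine (pow_le_pow_iff_left₀ (by positivity) (by positivity) (n := 4) (by norm_num)).1 ?_
  have h2 := pow_le_pow_left₀ (by positivity) h.le 2
  rw [mul_pow, sq_stepsize ha hF hδ hT] at h2
  rw [mul_pow, rate_pow_four hκ hW hn0 ha hF hδ hT, div_pow]
  have e : (16 * κ * n * a) ^ 2 * (δ ^ 3 * F / ((W * n) ^ 2 * (a * T)))
      = 256 * κ ^ 2 * a * F * δ ^ 3 / (W ^ 2 * T) := by
    field_simp
    ring
  rw [e, le_div_iff₀ (by positivity)] at h2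
  have h3 : δ ^ 3 * W ^ 2 * T ≤ 256 * κ ^ 2 * a * F := by
    refine le_of_mul_le_mul_right (a := δ ^ 3) ?_ (by positivity)
    linarith
  rw [← mul_div_assoc, div_le_div_iff₀ (by positivity) (by positivity)]
  have h4 : W ^ 2 * δ ^ 4 * (δ ^ 3 * W ^ 2 * T) ≤ W ^ 2 * δ ^ 4 * (256 * κ ^ 2 * a * F) := by
    gcongr
  have h5 : W ^ 2 * δ ^ 4 * (256 * κ ^ 2 * a * F) * 1 ≤
      W ^ 2 * δ ^ 4 * (256 * κ ^ 2 * a * F) * n ^ 2 := by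
    gcongr
    nlinarith
  linarith

theorem main_term_eq_const_step {κ n a F δ T : ℝ} (hκ : 0 < κ) (hn : 0 < n) (ha : 0 < a)
    (hF : 0 < F) (hδ : 0 < δ) (hT : 0 < T) :
    √(κ * F / (T * (δ ^ 4 / (16 * κ ^ 3 * n * a)))) / δ
      = 4 * (κ ^ 2 * √(a * n * F) / (δ ^ 3 * √T)) := by
  refine (pow_left_inj₀ (by positivity) (by positivity) (n := 2) (by norm_num)).1 ?_
  rw [div_pow, Real.sq_sqrt (by positivity), mul_pow, div_pow, mul_pow, mul_pow,
    Real.sq_sqrt (by positivity), Real.sq_sqrt hT.le]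
  field_simp
  norm_num

end MPG
end

/-! ### Assembly of the cases -/

theorem theorem3 :
    ∃ C : ℝ, 0 < C ∧
      ∀ (N A d K T : ℕ) (S : Type*) (G : MPG.Game N A S)
        (φ : Fin N → S → Fin A → EuclideanSpace ℝ (Fin d)) (W Φmax ε η ξ κ : ℝ)
        (Φ : MPG.Policy N A S → S → ℝ)
        (Ω : Type*) [MeasurableSpace Ω] (μ : MeasureTheory.Measure Ω)
        [MeasureTheory.IsProbabilityMeasure μ],
        2 ≤ N → 1 ≤ A → 1 ≤ T → 0 < W → 0 < ε →
        -- the game is a Markov potential game with potential `Φ` of range at most `Φmax`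
        G.IsPotential Φ → 0 < Φmax →
        (∀ (ν : PMF S) (π π' : MPG.Policy N A S),
          |MPG.expect ν (Φ π) - MPG.expect ν (Φ π')| ≤ Φmax) →
        -- the mismatch coefficient is finite, with value `κ`
        G.kappa ≠ ⊤ → κ = G.kappa.toReal →
        -- linear averaged action values
        G.LinearQ φ W →
        -- the algorithm, with its exploration rate
        ξ = min ((κ ^ 2 * N * A * ε / ((1 - G.γ) ^ 2 * W ^ 2)) ^ (1 / 3 : ℝ)) (1 / 2) →
        ∀ R : MPG.Run G φ W η ξ K T μ,
        -- bounded statistical error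
        (∀ t ∈ Finset.Icc 1 T, ∀ i,
          ∫⁻ ω, ENNReal.ofReal (G.regLoss φ (R.policy t ω) i (R.what t i ω)) ∂μ
            ≤ ENNReal.ofReal ε) →
        (η = (1 - G.γ) ^ (3 / 2 : ℝ) * √Φmax / (W * N * √(A * T)) →
          ∫⁻ ω, ENNReal.ofReal (G.nashRegret T fun t => R.policy t ω) ∂μ ≤
            ENNReal.ofReal (C *
              (√(κ * W * N) * (A * Φmax) ^ (1 / 4 : ℝ) /
                  ((1 - G.γ) ^ (7 / 4 : ℝ) * (T : ℝ) ^ (1 / 4 : ℝ)) +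
                (κ ^ 2 * W * A * N * ε / (1 - G.γ) ^ 5) ^ (1 / 3 : ℝ)))) ∧
        (η = (1 - G.γ) ^ 4 / (16 * κ ^ 3 * N * A) →
          ∫⁻ ω, ENNReal.ofReal (G.nashRegret T fun t => R.policy t ω) ∂μ ≤
            ENNReal.ofReal (C *
              (κ ^ 2 * √(A * N * Φmax) / ((1 - G.γ) ^ 3 * √(T : ℝ)) +
                (κ ^ 2 * W * A * N * ε / (1 - G.γ) ^ 5) ^ (1 / 3 : ℝ)))) := by
  -- 16 = 4 · 4: the factor 4 in front of the main term, times the factor 4 by which the constant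
  -- stepsize misses its rate. The other coefficients, 7, 4 and 8, are smaller.
  refine ⟨16, by norm_num, ?_⟩
  intro N A d K T S G φ W Φmax ε η ξ κ Φ Ω _ μ _ hN hA hT hW hε hΦ hΦ0 hΦν hk hκ hlin hξ R hstat
  have hN1 : 1 ≤ N := by omega
  have hT' : (0 : ℝ) < T := by exact_mod_cast hT
  have hA' : (1 : ℝ) ≤ A := by exact_mod_cast hA
  have hN' : (1 : ℝ) ≤ N := by exact_mod_cast hN1
  have hδ := MPG.Game.one_sub_pos (G := G)
  have hδ1 := MPG.Game.one_sub_le_one (G := G)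
  -- Point masses give a pointwise bound. It avoids expectations of Φ itself, which would take the
  -- default value 0 if the series diverged.
  have hΦmax : ∀ (π π' : MPG.Policy N A S) s, |Φ π s - Φ π' s| ≤ Φmax := by
    intro π π' s
    simpa only [MPG.expect_pure] using hΦν (PMF.pure s) π π'
  obtain ⟨ω₀⟩ : Nonempty Ω := μ.nonempty_of_neZero
  have hκ1 : 1 ≤ κ := hκ ▸ MPG.Game.one_le_kappa hk (R.policy 1 ω₀)
  have hstat0 := MPG.stat_term_eq (κ := κ) (n := N) (a := A) (ε := ε) (δ := 1 - G.γ) (W := W)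
    (by positivity) (by positivity) (by positivity) hε hδ hW
  have hx0 : 0 < κ ^ 2 * N * A * ε / ((1 - G.γ) ^ 2 * W ^ 2) := by positivity
  set δ := 1 - G.γ with hδdef
  set x := κ ^ 2 * N * A * ε / (δ ^ 2 * W ^ 2) with hx
  set Z := (κ ^ 2 * W * A * N * ε / δ ^ 5) ^ (1 / 3 : ℝ) with hZ
  have hcore : 0 < η → 16 * κ * N * A * η ≤ δ ^ 3 → ∀ B : ℝ, 0 ≤ B →
      √(κ * Φmax / (T * η)) / δ ≤ 4 * B →
      ∫⁻ ω, ENNReal.ofReal (G.nashRegret T fun t => R.policy t ω) ∂μ ≤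
        ENNReal.ofReal (16 * (B + Z)) := by
    intro hη hstep B hB0 hB
    -- If the exploration rate is truncated, the statistical term exceeds W/(2δ) and the trivial
    -- bound 2W/δ is at most four times it.
    rcases le_or_gt (x ^ (1 / 3 : ℝ)) (1 / 2) with h | h
    · rw [min_eq_left h] at hξ
      have hξ0 : 0 < ξ := by rw [hξ]; positivity
      have hξ3 : ξ ^ 3 = x := by rw [hξ]; exact MPG.rpow_one_third_cube hx0.le
      subst hκ
      refine (R.lintegral_nashRegret_le hN1 hA hT hΦ hΦ0 hΦmax hk hlin hW hξ0 (by linarith) hη hε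
        hstep hstat hξ3).trans (ENNReal.ofReal_le_ofReal ?_)
      rw [← hδdef, hstat0, ← hξ]
      have : 0 ≤ ξ * W / δ := by positivity
      linarith
    · refine R.lintegral_nashRegret_le_of_radius hN1 hT hlin ?_
      rw [← hδdef, hstat0]
      have h1 : 1 / 2 * W / δ ≤ x ^ (1 / 3 : ℝ) * W / δ := by gcongr
      have h2 : 2 * W / δ = 4 * (1 / 2 * W / δ) := by ring
      have h3 : 0 ≤ 1 / 2 * W / δ := by positivity
      linarith
  have hZ0 : 0 ≤ Z := by positivity
  refine ⟨fun hη => ?_, fun hη => ?_⟩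
  · rcases le_or_gt (16 * κ * N * A * η) (δ ^ 3) with h | h
    · refine hcore (by rw [hη]; positivity) h _ (by positivity) ?_
      rw [hη, MPG.main_term_eq_rate (by positivity) hW (by positivity) (by positivity) hΦ0 hδ hT']
      exact le_mul_of_one_le_left (by positivity) (by norm_num)
    · refine R.lintegral_nashRegret_le_of_radius hN1 hT hlin ?_
      rw [hη] at h
      have h1 := MPG.radius_le_rate (by positivity) hW hN' (by positivity) hΦ0 hδ hT' h
      have h2 : 2 * W / δ = 2 * (W / δ) := by ring
      have h3 : 0 ≤ W / δ := by positivity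
      rw [← hδdef, h2]
      linarith
  · refine hcore (by rw [hη]; positivity) ?_ _ (by positivity) ?_
    -- The constant stepsize always meets the smallness condition, as κ ≥ 1 and δ ≤ 1.
    · have e : 16 * κ * N * A * η = δ ^ 4 / κ ^ 2 := by
        rw [hη]
        field_simp
      rw [e, div_le_iff₀ (by positivity)]
      have : δ ^ 4 ≤ δ ^ 3 := pow_le_pow_of_le_one hδ.le hδ1 (by norm_num)
      have h2 : δ ^ 3 * 1 ≤ δ ^ 3 * κ ^ 2 := by
        gcongr
        nlinarith
      linarith
    · rw [hη, MPG.main_term_eq_const_step (by positivity) (by positivity) (by positivity) hΦ0 hδ hT']
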